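/- Let $n$ be a non-negative integer and $q=(q_1,\dots,q_n)\in(0,\infty)^n$. Let $\mathcal W^n=\{z\in\mathbb Z^n: z_1\le\dots\le z_n\}$, and let $\mathbb K_n$ be the set of integer Gelfand–Tsetlin patterns $x=(x^1,\dots,x^n)\in\mathbb Z^1\times\dots\times\mathbb Z^n$ with $x^{k+1}_i\le x^k_i\le x^{k+1}_{i+1}$ for $1\le i\le k<n$. Write $\mathbb K_n(z)=\{x\in\mathbb K_n: x^n=z\}$ for $z\in\mathbb Z^n$ (empty unless $z\in\mathcal W^n$), $|v|=\sum_i v_i$, $|x^0|=0$, and $$w^q(x)=\prod_{i=1}^n q_i^{|x^i|-|x^{i-1}|},\qquad S_z(q)=\sum_{x\in\mathbb K_n(z)}w^q(x),\qquad M_z(x)=\frac{w^q(x)}{S_z(q)}\quad (z\in\mathcal W^n,\ x\in\mathbb K_n(z)).$$ Let $(\mathfrak X(t);t\ge 0)$ be a continuous-time Markov process on $\mathbb K_n$ with the following dynamics. Each particle $\mathfrak X^k_j$ ($1\le j\le k\le n$) independently attempts to jump one unit to the right at rate $q_k$. The attempt is suppressed (blocked) if $j<k$ and $\mathfrak X^{k-1}_j=\mathfrak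 X^k_j$. If a particle $\mathfrak X^{k}_{j}$ with $k<n$ moves one unit to the right, whether by its own jump or because it is pushed, and just before the move $\mathfrak X^{k+1}_{j+1}=\mathfrak X^k_j$, then $\mathfrak X^{k+1}_{j+1}$ is pushed one unit to the right at the same time. If $\mathfrak X(0)$ has distribution $M_z$ for some $z\in\mathcal W^n$, then the bottom row $(\mathfrak X^n(t);t\ge0)$ is distributed as a Markov process on $\mathcal W^n$ started from $z$ with the conservative $Q$-matrix $$Q(x,x+e_i)=\frac{S_{x+e_i}(q)}{S_x(q)}\,\mathbf 1[x+e_i\in\mathcal W^n],\qquad 1\le i\le n,\ x\in\mathcal W^n,$$ all other off-diagonal entries being zero. Here a Markov process with a given $Q$-matrix is one whose finite-dimensional distributions are given by its initial distribution and a standard stochastic transition function whose right derivative at time $0$ is that $Q$-matrix. Moreover, $Q$ is a Doob $h$-transform: the function $h(x)=q_1^{-x_1}\cdots q_n^{-x_n}S_x(q)$ is strictly positive on $\mathcal W^n$ and harmonic for the generator $G$ of the random walk whose components are independent Poisson processes of rates $q_1,\dots,q_n$, killed when it first leaves $\mathcal W^n$, and $Q(x,y)=G(x,y)\,h(y)/h(x)$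 for all $x,y\in\mathcal W^n$ (diagonal entries included). -/

import Mathlib

open MeasureTheory Filter Topology
open scoped NNReal

/-! ### Continuous-time Markov chains on a countable state space -/

section MarkovChains

open Classical in
/-- `p t x y` is a standard stochastic transition function on `S` whose Q-matrix, that is the
entrywise right derivative at time `0`, is `Q`. -/
structure IsTransitionFunction {S : Type*} [Countable S] (Q : S → S → ℝ)
    (p : ℝ≥0 → S → S → ℝ) : Prop where
  nonneg : ∀ t x y, 0 ≤ p t x y
  sum_one : ∀ t x, HasSum (fun y => p t x y) 1
  zero : ∀ x y, p 0 x y = if y = x then 1 else 0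
  chapman_kolmogorov : ∀ s t x z, HasSum (fun y => p s x y * p t y z) (p (s + t) x z)
  deriv_zero : ∀ x y, Tendsto (fun t : ℝ≥0 => (p t x y - p 0 x y) / (t : ℝ)) (𝓝[>] 0) (𝓝 (Q x y))

/-- The process `X` with values in the countable discrete space `S`, defined on the probability
space `(Ω, P)`, is a Markov process with Q-matrix `Q` and initial distribution with mass function
`μ₀`: its finite-dimensional distributions are those given by `μ₀` and a transition function with
Q-matrix `Q`. -/
structure IsMarkovProcess {S : Type*} [Countable S] {Ω : Type*} [MeasurableSpace Ω]
    (P : Measure Ω) (Q : S → S → ℝ) (μ₀ : S → ℝ) (X : ℝ≥0 → Ω → S) : Prop where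
  measurable : ∀ t x, MeasurableSet {ω | X t ω = x}
  finite_dim : ∃ p : ℝ≥0 → S → S → ℝ, IsTransitionFunction Q p ∧
    ∀ (N : ℕ) (t : ℕ → ℝ≥0) (x : ℕ → S), t 0 = 0 → Monotone t →
      P.real {ω | ∀ i ≤ N, X (t i) ω = x i} =
        μ₀ (x 0) * ∏ i ∈ Finset.range N, p (t (i + 1) - t i) (x i) (x (i + 1))

end MarkovChains

/-! ### Gelfand-Tsetlin patterns -/

namespace GelfandTsetlin

/-- Triangular arrays `(x⁰, x¹, …, xⁿ)` of integers, the row `xᵏ` having `k` entries; the row `x⁰`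
is empty. -/
abbrev Rows (n : ℕ) : Type := (k : Fin (n + 1)) → Fin k → ℤ

/-- The interlacing conditions `xᵏ⁺¹ᵢ ≤ xᵏᵢ ≤ xᵏ⁺¹ᵢ₊₁`. -/
def Interlaced {n : ℕ} (x : Rows n) : Prop :=
  ∀ (k : Fin n) (i : Fin k),
    x k.succ i.castSucc ≤ x k.castSucc i ∧ x k.castSucc i ≤ x k.succ i.succ

/-- The set `𝕂ₙ` of integer Gelfand-Tsetlin patterns with `n` rows. -/
abbrev Pattern (n : ℕ) : Type := {x : Rows n // Interlaced x}

/-- The discrete Weyl chamber `𝒲ⁿ`: weakly increasing integer vectors. -/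
abbrev Weyl (n : ℕ) : Type := {z : Fin n → ℤ // Monotone z}

theorem bottom_monotone {n : ℕ} (x : Pattern n) :
    Monotone (x.1 (Fin.last n) : Fin n → ℤ) := by
  cases n with
  | zero => intro a; exact a.elim0
  | succ m =>
    rw [Fin.monotone_iff_le_succ]
    intro i
    have h := x.2 (Fin.last m) i
    exact h.1.trans h.2

/-- The bottom row `xⁿ` of a pattern. -/
def bottom {n : ℕ} (x : Pattern n) : Weyl n := ⟨x.1 (Fin.last n), bottom_monotone x⟩

/-! ### Schur functions and the weighted distribution on patterns -/

/-- There are finitely many patterns with a given bottom row. -/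
theorem finite_bottom {n : ℕ} (z : Fin n → ℤ) :
    {x : Pattern n | (bottom x).1 = z}.Finite := by
  obtain ⟨c, hc⟩ : ∃ c : ℤ, ∀ i, -c ≤ z i ∧ z i ≤ c := by
    refine ⟨∑ i, |z i|, fun i => ?_⟩
    have h : |z i| ≤ ∑ i, |z i| :=
      Finset.single_le_sum (f := fun i => |z i|) (fun _ _ => abs_nonneg _) (Finset.mem_univ i)
    exact abs_le.mp h
  refine Set.Finite.of_finite_image (f := Subtype.val) ?_ Subtype.val_injective.injOn
  refine (Set.finite_Icc (fun _ _ => -c : Rows n) (fun _ _ => c)).subset ?_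
  rintro _ ⟨x, hx, rfl⟩
  have key : ∀ (k : Fin (n + 1)) (i : Fin k), -c ≤ x.1 k i ∧ x.1 k i ≤ c := by
    intro k
    induction k using Fin.reverseInduction with
    | last =>
      intro i
      have h := congrFun hx i
      have h2 := hc i
      rw [← h] at h2
      exact h2
    | cast k ih =>
      intro i
      have h := x.2 k i
      exact ⟨(ih i.castSucc).1.trans h.1, h.2.trans (ih i.succ).2⟩
  exact ⟨fun k i => (key k i).1, fun k i => (key k i).2⟩

/-- The geometric weight `∏ᵢ qᵢ ^ (|xⁱ| - |xⁱ⁻¹|)`. -/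
noncomputable def weight {n : ℕ} (q : Fin n → ℝ) (x : Pattern n) : ℝ :=
  ∏ k : Fin n, q k ^ ((∑ i, x.1 k.succ i) - ∑ i, x.1 k.castSucc i)

/-- The Schur function `S_z(q)`, a sum over the patterns with bottom row `z`. -/
noncomputable def schur {n : ℕ} (q : Fin n → ℝ) (z : Fin n → ℤ) : ℝ :=
  ∑ x ∈ (finite_bottom z).toFinset, weight q x

open Classical in
/-- The mass function `M_z` on patterns, which is supported by the patterns with bottom row `z`. -/
noncomputable def patternMass {n : ℕ} (q : Fin n → ℝ) (z : Weyl n) (x : Pattern n) : ℝ :=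
  if bottom x = z then weight q x / schur q z.1 else 0

/-! ### The dynamics with blocking and pushing

For `l : Fin n`, the row with number `l + 1` of `x` is `x l.succ`, and its jump rate is `q l`. -/

/-- The particle `j` of row `l + 1` is blocked by the particle `j` of row `l` (there is none
if `j` is the last particle of its row). -/
def Blocked {n : ℕ} (x : Rows n) (l : Fin n) (j : Fin (l + 1)) : Prop :=
  ∃ i : Fin l, i.castSucc = j ∧ x l.castSucc i = x l.succ j

/-- The particles that move when the particle `j` of row `l + 1` jumps: this particle itself and,
successively, every particle `i + 1` of a row `k + 1` that is at the same position as a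
moving particle `i` of row `k`. -/
inductive Moves {n : ℕ} (x : Rows n) (l : Fin n) (j : Fin (l + 1)) :
    (k : Fin (n + 1)) → Fin k → Prop
  | jump : Moves x l j l.succ j
  | push (k : Fin n) (i : Fin k) : Moves x l j k.castSucc i →
      x k.castSucc i = x k.succ i.succ → Moves x l j k.succ i.succ

open Classical in
/-- The array after the jump of the particle `j` of row `l + 1`. -/
noncomputable def moved {n : ℕ} (x : Rows n) (l : Fin n) (j : Fin (l + 1)) : Rows n :=
  fun k i => if Moves x l j k i then x k i + 1 else x k i

theorem Moves.lt {n : ℕ} {x : Rows n} (hx : Interlaced x) {l : Fin n} {j : Fin (l + 1)}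
    (hb : ¬ Blocked x l j) {k' : Fin (n + 1)} {i' : Fin k'} (h : Moves x l j k' i') :
    ∀ (k : Fin n) (i : Fin k), k' = k.succ → (i' : ℕ) = i →
      x k.succ i.castSucc < x k.castSucc i := by
  induction h with
  | jump =>
    intro k i hk hi
    obtain rfl := Fin.succ_injective _ hk
    refine lt_of_le_of_ne (hx l i).1 fun he => hb ⟨i, Fin.ext hi.symm, ?_⟩
    rw [show j = i.castSucc from Fin.ext hi]
    exact he.symm
  | push m a hm he ih =>
    intro k i hk hi
    obtain rfl := Fin.succ_injective _ hk
    have hi2 : (i : ℕ) = a + 1 := by simpa using hi.symm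
    have hin := i.isLt
    obtain ⟨m', hm'⟩ : ∃ m' : Fin n, (m : ℕ) = m' + 1 :=
      ⟨⟨m - 1, by omega⟩, by simp; omega⟩
    have hmm : m.castSucc = m'.succ := Fin.ext (by simpa using hm')
    have e1 : x m.succ i.castSucc = x m.castSucc a := by
      rw [he]; congr 1; exact Fin.ext (by simpa using hi2)
    rw [e1]
    have ha : (a : ℕ) < m' := by omega
    have h1 := ih m' ⟨a, ha⟩ hmm rfl
    have h2 := (hx m' ⟨a, ha⟩).2
    have gen : ∀ (r : Fin (n + 1)) (b : Fin r) (r' : Fin (n + 1)) (b' : Fin r'),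
        r = r' → (b : ℕ) = b' → x r b = x r' b' := by
      intro r b r' b' hr hbb
      subst hr
      rw [Fin.ext hbb]
    rw [gen m.castSucc a m'.succ (Fin.castSucc ⟨a, ha⟩) hmm rfl,
      gen m.castSucc i m'.succ (Fin.succ ⟨a, ha⟩) hmm (by simpa using hi2)]
    exact h1.trans_le h2

theorem moved_interlaced {n : ℕ} {x : Rows n} (hx : Interlaced x) {l : Fin n} {j : Fin (l + 1)}
    (hb : ¬ Blocked x l j) : Interlaced (moved x l j) := by
  intro k i
  have h := hx k i
  constructor
  · by_cases h1 : Moves x l j k.succ i.castSucc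
    · have h3 := h1.lt hx hb k i rfl rfl
      by_cases h2 : Moves x l j k.castSucc i <;> simp only [moved, h1, h2, if_true, if_false] <;>
        omega
    · by_cases h2 : Moves x l j k.castSucc i <;> simp only [moved, h1, h2, if_true, if_false] <;>
        omega
  · by_cases h1 : Moves x l j k.castSucc i
    · by_cases h2 : Moves x l j k.succ i.succ
      · simp only [moved, h1, h2, if_true]; omega
      · have h3 : x k.castSucc i ≠ x k.succ i.succ := fun he => h2 (Moves.push k i h1 he)
        simp only [moved, h1, h2, if_true, if_false]; omega
    · by_cases h2 : Moves x l j k.succ i.succ <;> simp only [moved, h1, h2, if_true, if_false] <;>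
        omega

open Classical in
/-- The pattern after the particle `j` of row `l + 1` attempts to jump. -/
noncomputable def attempt {n : ℕ} (x : Pattern n) (l : Fin n) (j : Fin (l + 1)) : Pattern n :=
  if h : Blocked x.1 l j then x else ⟨moved x.1 l j, moved_interlaced x.2 h⟩

open Classical in
/-- The conservative Q-matrix of the process on patterns: every particle of row `l + 1` attempts
to jump at rate `q l`. -/
noncomputable def patternQ {n : ℕ} (q : Fin n → ℝ) (x y : Pattern n) : ℝ :=
  ∑ l : Fin n, ∑ j : Fin (l + 1),
    q l * ((if y = attempt x l j then 1 else 0) - (if y = x then 1 else 0))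

/-! ### The process on the Weyl chamber -/

open Classical in
/-- The rate `S_{x+eᵢ}(q) / S_x(q) · 1[x + eᵢ ∈ 𝒲ⁿ]`. -/
noncomputable def schurRate {n : ℕ} (q : Fin n → ℝ) (x : Weyl n) (i : Fin n) : ℝ :=
  if Monotone (x.1 + Pi.single i 1) then schur q (x.1 + Pi.single i 1) / schur q x.1 else 0

open Classical in
/-- The conservative Q-matrix on `𝒲ⁿ` with rates `schurRate q x i` from `x` to `x + eᵢ`. -/
noncomputable def weylQ {n : ℕ} (q : Fin n → ℝ) (x y : Weyl n) : ℝ :=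
  ∑ i : Fin n, schurRate q x i *
    ((if y.1 = x.1 + Pi.single i 1 then 1 else 0) - (if y = x then 1 else 0))

open Classical in
/-- The generator of `n` independent Poisson processes of rates `q i`, killed at the first instant
of leaving `𝒲ⁿ`. -/
noncomputable def killedWalkQ {n : ℕ} (q : Fin n → ℝ) (x y : Weyl n) : ℝ :=
  ∑ i : Fin n, q i * ((if y.1 = x.1 + Pi.single i 1 then 1 else 0) - (if y = x then 1 else 0))

/-- The function `h(x) = q₁^(-x₁) ⋯ qₙ^(-xₙ) S_x(q)`. -/
noncomputable def harmonicH {n : ℕ} (q : Fin n → ℝ) (x : Weyl n) : ℝ :=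
  (∏ i, q i ^ (-x.1 i)) * schur q x.1

/-- `h` is harmonic for the generator `G`. -/
def IsHarmonicFor {S : Type*} (G : S → S → ℝ) (h : S → ℝ) : Prop :=
  ∀ x, HasSum (fun y => G x y * h y) 0

/-- The Doob `h`-transform of the generator `G`. -/
noncomputable def doobTransform {S : Type*} (G : S → S → ℝ) (h : S → ℝ) (x y : S) : ℝ :=
  G x y * h y / h x

open Classical in
/-- The mass function of the distribution concentrated at `z`. -/
noncomputable def pointMass {S : Type*} (z x : S) : ℝ := if x = z then 1 else 0

end GelfandTsetlin

/-! Write Λ for the averaging of a function on patterns over the patterns with bottom row z, with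
weights `weight q`, divided by `schur q z` (`fiberMean`). The core is the intertwining of
generators, `fiberMean_patternGen`: Λ composed with the pattern generator equals the Weyl chamber
generator composed with Λ.

It rests on a bijection. A successful jump raises by one a segment of a diagonal, from the jumping
particle to the last pushed one, and can be reconstructed from the resulting pattern y and that last
particle. If the segment ends in row m < n, the bottom row is still z and the only constraint on y
is one strict inequality with row m + 1; if it ends in row n, the bottom row is z + e_i with no
further constraint. The weight times the jump rate becomes the weight of y times the rate of row m +
1 (or 1 if m = n). The blocked attempts supply exactly the terms where that inequality is an
equality (`sum_attempt`). Applied to the constant 1, this gives the Pieri rule, hence a constant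
total rate, the harmonicity of h and the Doob transform.

The intertwining passes to transition functions (`fiberMean_transition`) by the backward equation
and uniqueness for a bounded linear evolution. It says that the law M_z propagates: conditionally on
the bottom row up to the present, the pattern has law M at the current bottom row. Summing out the
upper rows one time after another yields the finite-dimensional distributions. -/

namespace IsTransitionFunction

/-! ### Continuity and the backward equation for transition functions. -/

variable {S : Type*} [Countable S] {Q : S → S → ℝ} {p : ℝ≥0 → S → S → ℝ}

theorem zero_self (h : IsTransitionFunction Q p) (x : S) : p 0 x x = 1 := by
  rw [h.zero, if_pos rfl]

theorem sum_le_one (h : IsTransitionFunction Q p) (t : ℝ≥0) (x : S) (F : Finset S) :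
    ∑ y ∈ F, p t x y ≤ 1 :=
  sum_le_hasSum F (fun y _ => h.nonneg t x y) (h.sum_one t x)

theorem le_one (h : IsTransitionFunction Q p) (t : ℝ≥0) (x y : S) : p t x y ≤ 1 := by
  simpa using h.sum_le_one t x {y}

/-- Averaging a function with values in `[0, 1]`: the contribution of the complement of a finite
set is at most the mass of this complement. -/
theorem sum_compl_bounds (h : IsTransitionFunction Q p) {s : ℝ≥0} {x : S} {g : S → ℝ} {a : ℝ}
    (hg0 : ∀ y, 0 ≤ g y) (hg1 : ∀ y, g y ≤ 1) (ha : HasSum (fun y => p s x y * g y) a)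
    (F : Finset S) :
    0 ≤ a - ∑ y ∈ F, p s x y * g y ∧
      a - ∑ y ∈ F, p s x y * g y ≤ 1 - ∑ y ∈ F, p s x y := by
  constructor
  · exact sub_nonneg.2 (sum_le_hasSum F (fun y _ => mul_nonneg (h.nonneg s x y) (hg0 y)) ha)
  · have h1 : HasSum (fun y => p s x y * (1 - g y)) (1 - a) := by
      simpa only [mul_sub, mul_one] using (h.sum_one s x).sub ha
    have h2 := sum_le_hasSum F
      (fun y _ => mul_nonneg (h.nonneg s x y) (sub_nonneg.2 (hg1 y))) h1
    simp only [mul_sub, mul_one, Finset.sum_sub_distrib] at h2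
    linarith

/-- Isolating the term of `x` in Chapman–Kolmogorov writes the difference as the remaining terms
minus `(1 - p s x x) * p t x z`; both lie in `[0, 1 - p s x x]`. -/
theorem abs_sub_le (h : IsTransitionFunction Q p) (s t : ℝ≥0) (x z : S) :
    |p (s + t) x z - p t x z| ≤ 1 - p s x x := by
  obtain ⟨h1, h2⟩ := h.sum_compl_bounds (fun y => h.nonneg t y z) (fun y => h.le_one t y z)
    (h.chapman_kolmogorov s t x z) {x}
  simp only [Finset.sum_singleton] at h1 h2
  have h3 := h.nonneg t x z
  have h4 := h.le_one t x z
  have h5 := h.le_one s x x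
  rw [abs_le]
  constructor <;> nlinarith

theorem tendsto_self (h : IsTransitionFunction Q p) (x : S) :
    Tendsto (fun t : ℝ≥0 => p t x x) (𝓝 0) (𝓝 1) := by
  have h1 : Tendsto (fun t : ℝ≥0 => (t : ℝ)) (𝓝[>] 0) (𝓝 0) :=
    (NNReal.continuous_coe.tendsto' 0 0 rfl).mono_left nhdsWithin_le_nhds
  have h2 := ((h.deriv_zero x x).mul h1).add_const (p 0 x x)
  rw [mul_zero, zero_add, h.zero_self] at h2
  have h3 : Tendsto (fun t : ℝ≥0 => p t x x) (𝓝[>] 0) (𝓝 1) := by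
    refine h2.congr' ?_
    filter_upwards [self_mem_nhdsWithin] with t ht
    have ht' : (t : ℝ) ≠ 0 := by
      have : (0 : ℝ≥0) < t := ht
      exact_mod_cast this.ne'
    field_simp
    ring
  rw [← nhdsNE_sup_pure (0 : ℝ≥0), tendsto_sup]
  refine ⟨?_, by simpa only [h.zero_self] using tendsto_pure_nhds (fun t : ℝ≥0 => p t x x) 0⟩
  refine h3.mono_left (nhdsWithin_mono _ fun t ht => ?_)
  exact pos_iff_ne_zero.2 ht

theorem continuous_time (h : IsTransitionFunction Q p) (x z : S) :
    Continuous (fun t : ℝ => p t.toNNReal x z) := by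
  have key : ∀ s t : ℝ≥0, |p s x z - p t x z| ≤ 1 - p (s - t + (t - s)) x x := by
    intro s t
    rcases le_total s t with hst | hst
    · have h1 := h.abs_sub_le (t - s) s x z
      rw [tsub_add_cancel_of_le hst] at h1
      rwa [tsub_eq_zero_of_le hst, zero_add, abs_sub_comm]
    · have h1 := h.abs_sub_le (s - t) t x z
      rw [tsub_add_cancel_of_le hst] at h1
      rwa [tsub_eq_zero_of_le hst, add_zero]
  have h1 : Continuous (fun t : ℝ≥0 => p t x z) := by
    rw [continuous_iff_continuousAt]
    intro t
    have h2 : Tendsto (fun s : ℝ≥0 => s - t + (t - s)) (𝓝 t) (𝓝 0) := by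
      have : Continuous (fun s : ℝ≥0 => s - t + (t - s)) := by fun_prop
      exact this.tendsto' _ _ (by simp)
    have h3 := ((h.tendsto_self x).comp h2).const_sub 1
    rw [sub_self] at h3
    rw [ContinuousAt, tendsto_iff_dist_tendsto_zero]
    exact squeeze_zero (fun _ => dist_nonneg) (fun s => by rw [Real.dist_eq]; exact key s t) h3
  exact h1.comp continuous_real_toNNReal

/-- Since the row of `Q` already sums to zero over the finite set `F`, the mass that `p s x` puts
outside `F` is o(s), so only `F` contributes to the derivative. -/
theorem tendsto_average (h : IsTransitionFunction Q p) {x : S} {F : Finset S} (hx : x ∈ F)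
    (hF : ∑ y ∈ F, Q x y = 0) {g : S → ℝ} {a : ℝ≥0 → ℝ} (hg0 : ∀ y, 0 ≤ g y)
    (hg1 : ∀ y, g y ≤ 1) (ha : ∀ s, HasSum (fun y => p s x y * g y) (a s)) :
    Tendsto (fun s : ℝ≥0 => (a s - g x) / (s : ℝ)) (𝓝[>] 0) (𝓝 (∑ y ∈ F, Q x y * g y)) := by
  classical
  have h0 : ∀ f : S → ℝ, ∑ y ∈ F, p 0 x y * f y = f x := by
    intro f
    simp [h.zero, hx]
  have h1 : Tendsto (fun s : ℝ≥0 => ∑ y ∈ F, (p s x y - p 0 x y) / (s : ℝ) * g y) (𝓝[>] 0)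
      (𝓝 (∑ y ∈ F, Q x y * g y)) :=
    tendsto_finsetSum _ fun y _ => (h.deriv_zero x y).mul_const _
  have h2 : Tendsto (fun s : ℝ≥0 => -∑ y ∈ F, (p s x y - p 0 x y) / (s : ℝ)) (𝓝[>] 0) (𝓝 0) := by
    have := (tendsto_finsetSum F fun y _ => h.deriv_zero x y).neg
    rwa [hF, neg_zero] at this
  have h3 : Tendsto (fun s : ℝ≥0 => (a s - ∑ y ∈ F, p s x y * g y) / (s : ℝ)) (𝓝[>] 0) (𝓝 0) := by
    refine squeeze_zero (fun s => div_nonneg ?_ s.2) (fun s => ?_) h2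
    · exact (h.sum_compl_bounds hg0 hg1 (ha s) F).1
    · have := (h.sum_compl_bounds hg0 hg1 (ha s) F).2
      have h4 : -∑ y ∈ F, (p s x y - p 0 x y) / (s : ℝ) = (1 - ∑ y ∈ F, p s x y) / (s : ℝ) := by
        rw [← Finset.sum_div, Finset.sum_sub_distrib, ← neg_div]
        have := h0 fun _ => 1
        simp only [mul_one] at this
        rw [this, neg_sub]
      rw [h4]
      exact div_le_div_of_nonneg_right this s.2
  have h5 := h3.add h1
  rw [zero_add] at h5
  refine h5.congr fun s => ?_
  simp only [div_mul_eq_mul_div, sub_mul]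
  rw [← Finset.sum_div, ← add_div, Finset.sum_sub_distrib, h0 g]
  ring

/-- The backward equation. -/
theorem hasDerivWithinAt_backward (h : IsTransitionFunction Q p) {x : S} {F : Finset S}
    (hx : x ∈ F) (hF : ∑ y ∈ F, Q x y = 0) (z : S) {t : ℝ} (ht : 0 ≤ t) :
    HasDerivWithinAt (fun t : ℝ => p t.toNNReal x z)
      (∑ y ∈ F, Q x y * p t.toNNReal y z) (Set.Ici t) t := by
  rw [← hasDerivWithinAt_Ioi_iff_Ici, hasDerivWithinAt_iff_tendsto_slope' (by simp)]
  have h1 := h.tendsto_average hx hF (fun y => h.nonneg t.toNNReal y z)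
    (fun y => h.le_one t.toNNReal y z) (fun s => h.chapman_kolmogorov s t.toNNReal x z)
  have h2 : Tendsto (fun s : ℝ => (s - t).toNNReal) (𝓝[>] t) (𝓝[>] 0) := by
    refine tendsto_nhdsWithin_of_tendsto_nhds_of_eventually_within _ ?_ ?_
    · have : Continuous (fun s : ℝ => (s - t).toNNReal) := by fun_prop
      exact (this.tendsto' t 0 (by simp)).mono_left nhdsWithin_le_nhds
    · filter_upwards [self_mem_nhdsWithin] with s hs
      exact Real.toNNReal_pos.2 (sub_pos.2 hs)
  refine (h1.comp h2).congr' ?_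
  filter_upwards [self_mem_nhdsWithin] with s hs
  have hs' : 0 ≤ s - t := (sub_pos.2 hs).le
  simp only [Function.comp, slope_def_field]
  rw [← Real.toNNReal_add hs' ht, sub_add_cancel, Real.coe_toNNReal _ hs']

end IsTransitionFunction

/-- Uniqueness for a linear evolution equation with bounded generator, in a pointwise form. -/
theorem eq_zero_of_linear_evolution {S : Type*} {f f' : ℝ → S → ℝ} {C : ℝ} {M : ℝ}
    (hc : ∀ z, Continuous fun t => f t z)
    (hd : ∀ z t, 0 ≤ t → HasDerivWithinAt (fun t => f t z) (f' t z) (Set.Ici t) t)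
    (hf' : ∀ t B, 0 ≤ t → (∀ z, |f t z| ≤ B) → ∀ z, |f' t z| ≤ C * B)
    (h0 : ∀ z, f 0 z = 0) (hM : ∀ t z, |f t z| ≤ M) {t : ℝ} (ht : 0 ≤ t) (z : S) : f t z = 0 := by
  -- Picard iteration: each integration of the bound on the derivative gains a factor of the
  -- exponential series, uniformly in `z`.
  have key : ∀ k : ℕ, ∀ t : ℝ, 0 ≤ t → ∀ z, |f t z| ≤ M * ((C * t) ^ k / k.factorial) := by
    intro k
    induction k with
    | zero => intro t _ z; simpa using hM t z
    | succ k ih =>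
      intro t ht z
      have hder : ∀ s : ℝ, HasDerivAt (fun s : ℝ => M * ((C * s) ^ (k + 1) / (k + 1).factorial))
          (C * (M * ((C * s) ^ k / k.factorial))) s := by
        intro s
        have h1 := ((((hasDerivAt_id s).const_mul C).pow (k + 1)).div_const
          ((k + 1).factorial : ℝ)).const_mul M
        refine h1.congr_deriv ?_
        rw [Nat.factorial_succ]
        push_cast
        have : ((k : ℝ) + 1) ≠ 0 := by positivity
        have : (k.factorial : ℝ) ≠ 0 := by positivity
        simp only [id]
        field_simp
      have h2 := image_norm_le_of_norm_deriv_right_le_deriv_boundary (a := 0) (b := t)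
        (f := fun s => f s z) (f' := fun s => f' s z) (hc z).continuousOn
        (fun s hs => hd z s hs.1) (B := fun s : ℝ => M * ((C * s) ^ (k + 1) / (k + 1).factorial))
        (B' := fun s => C * (M * ((C * s) ^ k / k.factorial))) (by simp [h0]) hder
        (fun s hs => hf' s _ hs.1 (ih s hs.1) z)
      exact h2 (Set.right_mem_Icc.2 ht)
  have h1 : Tendsto (fun k : ℕ => M * ((C * t) ^ k / k.factorial)) atTop (𝓝 0) := by
    simpa using (FloorSemiring.tendsto_pow_div_factorial_atTop (C * t)).const_mul M
  have h2 : |f t z| ≤ 0 := ge_of_tendsto' h1 fun k => key k t ht z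
  exact abs_nonpos_iff.1 h2

/-! ### Triangular arrays with natural indices and shifts along diagonals. -/

namespace GelfandTsetlin

/-- The entries of a triangular array, extended by `0` to all pairs of natural numbers. -/
def entry {n : ℕ} (x : Rows n) (k i : ℕ) : ℤ :=
  if h : k < n + 1 ∧ i < k then x ⟨k, h.1⟩ ⟨i, h.2⟩ else 0

theorem entry_val {n : ℕ} (x : Rows n) (k : Fin (n + 1)) (i : Fin k) :
    entry x k i = x k i := by
  rw [entry, dif_pos ⟨k.2, i.2⟩]

theorem entry_of_lt {n : ℕ} (x : Rows n) {k i : ℕ} (hk : k < n + 1) (hi : i < k) :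
    entry x k i = x ⟨k, hk⟩ ⟨i, hi⟩ := by
  rw [entry, dif_pos ⟨hk, hi⟩]

theorem interlaced_iff {n : ℕ} {x : Rows n} :
    Interlaced x ↔ ∀ k i : ℕ, k < n → i < k →
      entry x (k + 1) i ≤ entry x k i ∧ entry x k i ≤ entry x (k + 1) (i + 1) := by
  constructor
  · intro h k i hk hi
    have := h ⟨k, hk⟩ ⟨i, hi⟩
    rwa [← entry_val x (Fin.succ _) (Fin.castSucc _), ← entry_val x (Fin.castSucc ⟨k, hk⟩) ⟨i, hi⟩,
      ← entry_val x (Fin.succ _) (Fin.succ _)] at this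
  · intro h k i
    have := h k i k.2 i.2
    rwa [← entry_val x k.succ i.castSucc, ← entry_val x k.castSucc i,
      ← entry_val x k.succ i.succ]

/-- Adding `c` to the entries with indices between `j` and `i` of the diagonal `d`, which consists
of the entries number `a` of the rows `d + a`. -/
def shiftDiag {n : ℕ} (x : Rows n) (c : ℤ) (d j i : ℕ) : Rows n :=
  fun k a => x k a + if (k : ℕ) = d + a ∧ j ≤ a ∧ (a : ℕ) ≤ i then c else 0

theorem entry_shiftDiag {n : ℕ} (x : Rows n) (c : ℤ) (d j i : ℕ) {k a : ℕ} (hk : k ≤ n)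
    (ha : a < k) : entry (shiftDiag x c d j i) k a =
      entry x k a + if k = d + a ∧ j ≤ a ∧ a ≤ i then c else 0 := by
  rw [entry_of_lt _ (Nat.lt_succ_of_le hk) ha, entry_of_lt _ (Nat.lt_succ_of_le hk) ha]
  rfl

theorem shiftDiag_shiftDiag_neg {n : ℕ} (x : Rows n) (c : ℤ) (d j i : ℕ) :
    shiftDiag (shiftDiag x (-c) d j i) c d j i = x := by
  funext k a
  simp only [shiftDiag]
  split_ifs <;> ring

theorem sum_shiftDiag {n : ℕ} (x : Rows n) (c : ℤ) {d j i : ℕ} (hd : 0 < d) (k : Fin (n + 1)) :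
    ∑ a, shiftDiag x c d j i k a =
      ∑ a, x k a + if d + j ≤ (k : ℕ) ∧ (k : ℕ) ≤ d + i then c else 0 := by
  simp only [shiftDiag, Finset.sum_add_distrib]
  congr 1
  split_ifs with h
  · have hk : (k : ℕ) - d < k := by omega
    rw [Finset.sum_eq_single ⟨(k : ℕ) - d, hk⟩, if_pos]
    · simp only; omega
    · intro b _ hb
      rw [if_neg]
      rintro ⟨h1, h2, h3⟩
      exact hb (Fin.ext (by simp only; omega))
    · simp
  · refine Finset.sum_eq_zero fun a _ => if_neg ?_
    rintro ⟨h1, h2, h3⟩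
    omega

theorem weight_pos {n : ℕ} {q : Fin n → ℝ} (hq : ∀ i, 0 < q i) (x : Pattern n) :
    0 < weight q x :=
  Finset.prod_pos fun k _ => zpow_pos (hq k) _

/-- The rate of the row following row `m`, and `1` if there is none. -/
noncomputable def nextRate {n : ℕ} (q : Fin n → ℝ) (m : Fin (n + 1)) : ℝ :=
  if h : (m : ℕ) < n then q ⟨m, h⟩ else 1

/-- The sums of the rows `d + j` to `d + i` grow by one, so only two exponents change: row `d + j`
gains a factor `q l`, and the row after `d + i`, if any, loses its rate. -/
theorem weight_shiftDiag {n : ℕ} {q : Fin n → ℝ} (hq : ∀ i, 0 < q i) {x y : Pattern n} {d j i : ℕ}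
    (hd : 0 < d) (hji : j ≤ i) (l : Fin n) (hl : (l : ℕ) + 1 = d + j) (m : Fin (n + 1))
    (hm : (m : ℕ) = d + i) (hy : y.1 = shiftDiag x.1 1 d j i) :
    weight q y * nextRate q m = weight q x * q l := by
  have h1 : ∀ k : Fin n, q k ^ ((∑ a, y.1 k.succ a) - ∑ a, y.1 k.castSucc a) *
      (if (k : ℕ) = m then q k else 1) =
      q k ^ ((∑ a, x.1 k.succ a) - ∑ a, x.1 k.castSucc a) * (if k = l then q k else 1) := by
    intro k
    have hk := (hq k).ne'
    rw [hy, sum_shiftDiag _ _ hd, sum_shiftDiag _ _ hd]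
    simp only [Fin.val_succ, Fin.val_castSucc, Fin.ext_iff]
    have e1 : (if (k : ℕ) = m then q k else 1) = q k ^ (if (k : ℕ) = m then 1 else 0 : ℤ) := by
      split_ifs <;> simp
    have e2 : (if (k : ℕ) = l then q k else 1) = q k ^ (if (k : ℕ) = l then 1 else 0 : ℤ) := by
      split_ifs <;> simp
    rw [e1, e2, ← zpow_add₀ hk, ← zpow_add₀ hk]
    congr 1
    split_ifs <;> omega
  have h2 := Finset.prod_congr (rfl : (Finset.univ : Finset (Fin n)) = Finset.univ)
    fun k _ => h1 k
  rw [Finset.prod_mul_distrib, Finset.prod_mul_distrib, Finset.prod_ite_eq' Finset.univ l,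
    if_pos (Finset.mem_univ l)] at h2
  rw [weight, weight, ← h2]
  congr 1
  rw [nextRate]
  split_ifs with h
  · rw [Finset.prod_eq_single ⟨m, h⟩]
    · simp
    · intro b _ hb
      rw [if_neg fun hh => hb (Fin.ext hh)]
    · simp
  · refine (Finset.prod_eq_one fun k _ => if_neg ?_).symm
    have := k.2
    omega

/-! ### Jumps as shifts of a diagonal segment. -/

theorem blocked_iff {n : ℕ} {x : Rows n} {l : Fin n} {j : Fin (l + 1)} :
    Blocked x l j ↔ (j : ℕ) < l ∧ entry x l j = entry x (l + 1) j := by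
  constructor
  · rintro ⟨i, rfl, h⟩
    refine ⟨i.2, ?_⟩
    rwa [← entry_val x l.castSucc i, ← entry_val x l.succ i.castSucc] at h
  · rintro ⟨h1, h2⟩
    refine ⟨⟨j, h1⟩, Fin.ext rfl, ?_⟩
    rwa [← entry_val x l.castSucc ⟨j, h1⟩, ← entry_val x l.succ j]

/-- The jump of the particle `j` on the diagonal `d` moves exactly the particles with indices
between `j` and `i` on this diagonal. -/
structure IsPushedChain {n : ℕ} (x : Rows n) (d j i : ℕ) : Prop where
  pos : 0 < d
  le : j ≤ i
  add_le : d + i ≤ n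
  eq : ∀ a, j ≤ a → a < i → entry x (d + a) a = entry x (d + a + 1) (a + 1)
  lt : d + i < n → entry x (d + i) i < entry x (d + i + 1) (i + 1)

theorem IsPushedChain.unique {n : ℕ} {x : Rows n} {d j i i' : ℕ} (h : IsPushedChain x d j i)
    (h' : IsPushedChain x d j i') : i = i' := by
  rcases lt_trichotomy i i' with hlt | heq | hlt
  · have h1 := h.lt (by have := h'.add_le; omega)
    have h2 := h'.eq i h.le hlt
    omega
  · exact heq
  · have h1 := h'.lt (by have := h.add_le; omega)
    have h2 := h.eq i' h'.le hlt
    omega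

theorem exists_isPushedChain {n : ℕ} {x : Rows n} (hx : Interlaced x) {d j : ℕ} (hd : 0 < d)
    (hj : d + j ≤ n) : ∃ i, IsPushedChain x d j i := by
  classical
  -- The chain ends at the first particle that pushes nobody; in the last row this holds vacuously,
  -- so the search succeeds by `n - d`.
  let P : ℕ → Prop := fun i => j ≤ i ∧ (d + i < n → entry x (d + i) i < entry x (d + i + 1) (i + 1))
  have hP : ∃ i, P i := ⟨n - d, by omega, fun h => by omega⟩
  have hle : Nat.find hP ≤ n - d := Nat.find_min' hP ⟨by omega, fun h => by omega⟩
  refine ⟨Nat.find hP, hd, (Nat.find_spec hP).1, by omega, fun a ha1 ha2 => ?_,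
    (Nat.find_spec hP).2⟩
  have h1 := Nat.find_min hP ha2
  have h2 : ¬ entry x (d + a) a < entry x (d + a + 1) (a + 1) := fun h => h1 ⟨ha1, fun _ => h⟩
  have h3 := (interlaced_iff.1 hx (d + a) a (by omega) (by omega)).2
  omega

/-- A push increases the row and the index by one together, so it never leaves the diagonal. -/
theorem moves_iff {n : ℕ} {x : Rows n} {l : Fin n} {j : Fin (l + 1)} {d i : ℕ}
    (h : IsPushedChain x d j i) (hl : (l : ℕ) + 1 = d + j) (k : Fin (n + 1)) (a : Fin k) :
    Moves x l j k a ↔ (k : ℕ) = d + a ∧ (j : ℕ) ≤ a ∧ (a : ℕ) ≤ i := by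
  constructor
  · intro hm
    induction hm with
    | jump => exact ⟨by simpa using hl, le_rfl, h.le⟩
    | push k a hm he ih =>
      simp only [Fin.val_castSucc, Fin.val_succ] at ih ⊢
      refine ⟨by omega, by omega, ?_⟩
      by_contra hlt
      obtain ⟨h1, h2, h3⟩ := ih
      obtain rfl : (a : ℕ) = i := by omega
      have h4 := h.lt (by omega)
      rw [← entry_val x k.castSucc a, ← entry_val x k.succ a.succ] at he
      simp only [Fin.val_castSucc, Fin.val_succ, h1] at he
      omega
  · rintro ⟨h1, h2, h3⟩
    obtain ⟨b, hb⟩ := Nat.exists_eq_add_of_le h2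
    induction b generalizing k a with
    | zero =>
      obtain rfl : k = l.succ := Fin.ext (by simp only [Fin.val_succ]; omega)
      obtain rfl : a = j := Fin.ext (by omega)
      exact Moves.jump
    | succ b ih =>
      have hk := k.2
      obtain ⟨k', rfl⟩ : ∃ k' : Fin n, k = k'.succ :=
        ⟨⟨(k : ℕ) - 1, by omega⟩, Fin.ext (by simp only [Fin.val_succ]; omega)⟩
      simp only [Fin.val_succ] at h1
      obtain ⟨a', rfl⟩ : ∃ a' : Fin k', a = a'.succ :=
        ⟨⟨(a : ℕ) - 1, by have := h.pos; omega⟩, Fin.ext (by simp only [Fin.val_succ]; omega)⟩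
      simp only [Fin.val_succ] at h1 h2 h3 hb
      refine Moves.push k' a' (ih k'.castSucc a' ?_ ?_ ?_ ?_) ?_
      · simp only [Fin.val_castSucc]; omega
      · omega
      · omega
      · omega
      · rw [← entry_val x k'.castSucc a', ← entry_val x k'.succ a'.succ]
        simp only [Fin.val_castSucc, Fin.val_succ]
        have := h.eq a' (by omega) (by omega)
        rwa [show d + (a' : ℕ) = k' by omega] at this

theorem moved_eq_shiftDiag {n : ℕ} {x : Rows n} {l : Fin n} {j : Fin (l + 1)} {d i : ℕ}
    (h : IsPushedChain x d j i) (hl : (l : ℕ) + 1 = d + j) :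
    moved x l j = shiftDiag x 1 d j i := by
  funext k a
  simp only [moved, shiftDiag, moves_iff h hl]
  split_ifs <;> ring

/-! ### Reconstructing a jump from its result. -/

/-- The particle number `i` of row `m` can move one unit to the left without having to push a
particle of the next row. -/
def Retractable {n : ℕ} (y : Rows n) (m i : ℕ) : Prop :=
  (m < n → entry y (m + 1) i < entry y m i) ∧ (0 < i → entry y m (i - 1) < entry y m i)

/-- If a jump has moved particles of the diagonal `d`, the last of which is the particle number
`i`, then the jumping particle was the particle number `j` of this diagonal. -/
structure IsPullingChain {n : ℕ} (y : Rows n) (d j i : ℕ) : Prop where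
  le : j ≤ i
  eq : ∀ a, j ≤ a → a < i → entry y (d + a) a = entry y (d + a + 1) (a + 1)
  lt : 0 < j → entry y (d + j - 1) (j - 1) < entry y (d + j) j

theorem exists_isPullingChain {n : ℕ} {y : Rows n} (hy : Interlaced y) {d i : ℕ} (hd : 0 < d)
    (hi : d + i ≤ n) : ∃ j, IsPullingChain y d j i := by
  induction i with
  | zero => exact ⟨0, le_rfl, fun a _ h => by omega, fun h => by omega⟩
  | succ i ih =>
    by_cases h : entry y (d + i) i < entry y (d + i + 1) (i + 1)
    · exact ⟨i + 1, le_rfl, fun a _ h => by omega, fun _ => h⟩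
    · obtain ⟨j, hj⟩ := ih (by omega)
      refine ⟨j, hj.le.trans (Nat.le_succ i), fun a ha1 ha2 => ?_, hj.lt⟩
      rcases (Nat.lt_succ_iff.1 ha2).lt_or_eq with h1 | rfl
      · exact hj.eq a ha1 h1
      · have := (interlaced_iff.1 hy (d + a) a (by omega) (by omega)).2
        omega

/-- Retractability descends the chain: in the row below, particle `a + 1` is strictly to the right
of particle `a` and level with particle `a` of the present row. This gives the first condition, and
interlacing then gives the second. -/
theorem IsPullingChain.retractable {n : ℕ} {y : Rows n} (hy : Interlaced y) {d j i : ℕ}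
    (hd : 0 < d) (hi : d + i ≤ n) (hj : IsPullingChain y d j i) (hr : Retractable y (d + i) i)
    {a : ℕ} (ha : j ≤ a) (hai : a ≤ i) : Retractable y (d + a) a := by
  obtain ⟨b, rfl⟩ := Nat.exists_eq_add_of_le hai
  induction b generalizing a with
  | zero => exact hr
  | succ b ih =>
    have hh := ih (a := a + 1) (by omega) (by rwa [show a + 1 + b = a + (b + 1) by omega])
      (by rwa [show a + 1 + b = a + (b + 1) by omega])
      (by rwa [show a + 1 + b = a + (b + 1) by omega]) (by omega)
    have h1 := hh.2 (by omega)
    have h2 := hj.eq a ha (by omega)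
    simp only [add_tsub_cancel_right, ← add_assoc] at h1
    refine ⟨fun _ => by omega, fun h0 => ?_⟩
    have h3 := (interlaced_iff.1 hy (d + a) (a - 1) (by omega) (by omega)).2
    rw [Nat.sub_add_cancel h0] at h3
    omega

/-- Only two kinds of inequality are at risk: the lower bounds of the moved particles, protected by
`Retractable`, and the upper bound of the particle just before the segment, protected by the
strictness `hj.lt`. -/
theorem interlaced_shiftDiag_neg {n : ℕ} {y : Rows n} (hy : Interlaced y) {d j i : ℕ}
    (hd : 0 < d) (hi : d + i ≤ n) (hj : IsPullingChain y d j i) (hr : Retractable y (d + i) i) :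
    Interlaced (shiftDiag y (-1) d j i) := by
  rw [interlaced_iff]
  intro k a hk ha
  have h := interlaced_iff.1 hy k a hk ha
  rw [entry_shiftDiag _ _ _ _ _ (by omega) (by omega), entry_shiftDiag _ _ _ _ _ (by omega) ha,
    entry_shiftDiag _ _ _ _ _ (by omega) (by omega)]
  constructor
  · by_cases h1 : k = d + a ∧ j ≤ a ∧ a ≤ i
    · have h2 := (hj.retractable hy hd hi hr h1.2.1 h1.2.2).1 (by omega)
      rw [← h1.1] at h2
      split_ifs <;> omega
    · split_ifs <;> omega
  · by_cases h1 : k + 1 = d + (a + 1) ∧ j ≤ a + 1 ∧ a + 1 ≤ i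
    · by_cases h2 : j ≤ a
      · split_ifs <;> omega
      · obtain rfl : j = a + 1 := by omega
        have h3 := hj.lt (by omega)
        have h4 : d + (a + 1) - 1 = k := by omega
        rw [h4, ← h1.1, add_tsub_cancel_right] at h3
        split_ifs <;> omega
    · split_ifs <;> omega

theorem isPushedChain_shiftDiag_neg {n : ℕ} {y : Rows n} (hy : Interlaced y) {d j i : ℕ}
    (hd : 0 < d) (hi : d + i ≤ n) (hj : IsPullingChain y d j i) :
    IsPushedChain (shiftDiag y (-1) d j i) d j i := by
  refine ⟨hd, hj.le, hi, fun a ha1 ha2 => ?_, fun hlt => ?_⟩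
  · rw [entry_shiftDiag _ _ _ _ _ (by omega) (by omega),
      entry_shiftDiag _ _ _ _ _ (by omega) (by omega), hj.eq a ha1 ha2, if_pos (by omega),
      if_pos (by omega)]
  · have := (interlaced_iff.1 hy (d + i) i (by omega) (by omega)).2
    have := hj.le
    rw [entry_shiftDiag _ _ _ _ _ (by omega) (by omega),
      entry_shiftDiag _ _ _ _ _ (by omega) (by omega), if_pos (by omega),
      if_neg (by omega)]
    omega

/-- If `j' < j`, the particles `j - 1` and `j` of the diagonal are level in `y`, as both are moved
in the primed chain. In `x` only the second one moves, so it was one unit behind the first, against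
interlacing. -/
theorem IsPushedChain.start_unique {n : ℕ} {x x' y : Rows n} (hx : Interlaced x)
    (hx' : Interlaced x') {d j j' i : ℕ} (h : IsPushedChain x d j i)
    (h' : IsPushedChain x' d j' i) (hy : y = shiftDiag x 1 d j i)
    (hy' : y = shiftDiag x' 1 d j' i) : j = j' := by
  have key : ∀ {x x' : Rows n}, Interlaced x → Interlaced x' → ∀ {j j' : ℕ},
      IsPushedChain x d j i → IsPushedChain x' d j' i → y = shiftDiag x 1 d j i →
      y = shiftDiag x' 1 d j' i → ¬ j' < j := by
    intro x x' hx hx' j j' h h' hy hy' hlt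
    obtain ⟨a, rfl⟩ : ∃ a, j = a + 1 := ⟨j - 1, by omega⟩
    have h1 := h.le
    have h2 := h.add_le
    have h3 := h.pos
    have e := h'.eq a (by omega) (by omega)
    have i1 := (interlaced_iff.1 hx (d + a) a (by omega) (by omega)).2
    have e1 := entry_shiftDiag x 1 d (a + 1) i (k := d + a) (a := a) (by omega) (by omega)
    have e2 := entry_shiftDiag x 1 d (a + 1) i (k := d + a + 1) (a := a + 1) (by omega) (by omega)
    have e3 := entry_shiftDiag x' 1 d j' i (k := d + a) (a := a) (by omega) (by omega)
    have e4 := entry_shiftDiag x' 1 d j' i (k := d + a + 1) (a := a + 1) (by omega) (by omega)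
    rw [← hy] at e1 e2
    rw [← hy'] at e3 e4
    rw [if_neg (by omega)] at e1
    rw [if_pos (by omega)] at e2 e3 e4
    omega
  have h1 := key hx hx' h h' hy hy'
  have h2 := key hx' hx h' h hy' hy
  omega

theorem shiftDiag_injective {n : ℕ} {x x' : Rows n} {c : ℤ} {d j i : ℕ}
    (h : shiftDiag x c d j i = shiftDiag x' c d j i) : x = x' := by
  funext k a
  have := congrFun (congrFun h k) a
  simpa [shiftDiag] using this

theorem not_blocked_of_shiftDiag {n : ℕ} {x : Rows n} {d j i : ℕ} (h : IsPushedChain x d j i)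
    (hs : Interlaced (shiftDiag x 1 d j i)) {l : Fin n} {j' : Fin (l + 1)}
    (hl : (l : ℕ) + 1 = d + j) (hj : (j' : ℕ) = j) : ¬ Blocked x l j' := by
  rw [blocked_iff, hj]
  rintro ⟨h1, h2⟩
  have h3 := (interlaced_iff.1 hs l j l.2 h1).1
  have h4 := h.le
  have h5 := l.2
  rw [entry_shiftDiag _ _ _ _ _ (by omega) (by omega),
    entry_shiftDiag _ _ _ _ _ (by omega) (by omega), if_pos (by omega), if_neg (by omega)] at h3
  omega

theorem entry_lt_of_shiftDiag {n : ℕ} {x : Rows n} (hx : Interlaced x) {d j i : ℕ}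
    (h : IsPushedChain x d j i) :
    d + i < n →
      entry (shiftDiag x 1 d j i) (d + i + 1) i < entry (shiftDiag x 1 d j i) (d + i) i := by
  intro hlt
  have := h.le
  have := h.pos
  rw [entry_shiftDiag _ _ _ _ _ (by omega) (by omega),
    entry_shiftDiag _ _ _ _ _ (by omega) (by omega), if_neg (by omega), if_pos (by omega)]
  have := (interlaced_iff.1 hx (d + i) i hlt (by omega)).1
  omega

end GelfandTsetlin

/-- A bijection given by its graph, which spares explicit inverse maps between dependent pairs. -/
theorem Finset.sum_eq_sum_of_rel {α β M : Type*} [AddCommMonoid M] {s : Finset α} {t : Finset β}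
    {f : α → M} {g : β → M} (R : α → β → Prop) (hs : ∀ a ∈ s, ∃ b ∈ t, R a b)
    (ht : ∀ b ∈ t, ∃ a ∈ s, R a b) (hl : ∀ a ∈ s, ∀ a' ∈ s, ∀ b ∈ t, R a b → R a' b → a = a')
    (hr : ∀ a ∈ s, ∀ b ∈ t, ∀ b' ∈ t, R a b → R a b' → b = b')
    (h : ∀ a ∈ s, ∀ b ∈ t, R a b → f a = g b) : ∑ a ∈ s, f a = ∑ b ∈ t, g b := by
  choose φ hφ hR using hs
  refine Finset.sum_bij φ hφ (fun a ha a' ha' he => ?_) (fun b hb => ?_)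
    (fun a ha => h a ha _ (hφ a ha) (hR a ha))
  · exact hl a ha a' ha' _ (hφ a ha) (hR a ha) (he ▸ hR a' ha')
  · obtain ⟨a, ha, hab⟩ := ht b hb
    exact ⟨a, ha, hr a ha _ (hφ a ha) b hb (hR a ha) hab⟩

/-! ### The bijection between jumps and their ends. -/

namespace GelfandTsetlin

theorem mem_fiber {n : ℕ} {z : Fin n → ℤ} {x : Pattern n} :
    x ∈ (finite_bottom z).toFinset ↔ (bottom x).1 = z := by
  simp

theorem bottom_apply {n : ℕ} (x : Pattern n) (a : Fin n) : (bottom x).1 a = entry x.1 n a :=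
  (entry_val x.1 (Fin.last n) a).symm

theorem bottom_shiftDiag_of_lt {n : ℕ} {x y : Pattern n} {d j i : ℕ} (hi : d + i < n)
    (hy : y.1 = shiftDiag x.1 1 d j i) : bottom y = bottom x := by
  refine Subtype.ext (funext fun a => ?_)
  rw [bottom_apply, bottom_apply, hy, entry_shiftDiag _ _ _ _ _ le_rfl a.2, if_neg (by omega),
    add_zero]

theorem bottom_shiftDiag_of_eq {n : ℕ} {x y : Pattern n} {d j : ℕ} {i : Fin n} (hi : d + i = n)
    (hji : j ≤ i) (hy : y.1 = shiftDiag x.1 1 d j i) :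
    (bottom y).1 = (bottom x).1 + Pi.single i 1 := by
  funext a
  rw [bottom_apply, Pi.add_apply, bottom_apply, hy, entry_shiftDiag _ _ _ _ _ le_rfl a.2,
    Pi.single_apply]
  congr 1
  refine if_congr ⟨fun h => Fin.ext ?_, fun h => ?_⟩ rfl rfl
  · omega
  · subst h
    exact ⟨hi.symm, hji, le_rfl⟩

/-- `x` becomes `y` when the particle `a.2` of row `a.1 + 1` jumps, and the last particle which
moves is the particle `b.2` of row `b.1`. -/
def JumpLeadsTo {n : ℕ} (a : Pattern n × Σ l : Fin n, Fin (l + 1))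
    (b : Pattern n × Σ m : Fin (n + 1), Fin m) : Prop :=
  ∃ d : ℕ, (a.2.1 : ℕ) + 1 = d + a.2.2 ∧ (b.2.1 : ℕ) = d + b.2.2 ∧
    IsPushedChain a.1.1 d a.2.2 b.2.2 ∧ b.1.1 = shiftDiag a.1.1 1 d a.2.2 b.2.2

/-- The possible ends of a jump from a pattern with bottom row `z`. -/
def IsJumpEnd {n : ℕ} (z : Fin n → ℤ) (b : Pattern n × Σ m : Fin (n + 1), Fin m) : Prop :=
  ((b.2.1 : ℕ) < n → entry b.1.1 (b.2.1 + 1) b.2.2 < entry b.1.1 b.2.1 b.2.2 ∧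
    (bottom b.1).1 = z) ∧
  ∀ h : (b.2.1 : ℕ) = n, (bottom b.1).1 = z + Pi.single (Fin.cast h b.2.2) 1

theorem JumpLeadsTo.isJumpEnd {n : ℕ} {a : Pattern n × Σ l : Fin n, Fin (l + 1)}
    {b : Pattern n × Σ m : Fin (n + 1), Fin m} (h : JumpLeadsTo a b) :
    IsJumpEnd (bottom a.1).1 b := by
  obtain ⟨d, h1, h2, h3, h4⟩ := h
  refine ⟨fun hlt => ⟨?_, ?_⟩, fun he => ?_⟩
  · have h5 := entry_lt_of_shiftDiag a.1.2 h3 (by omega)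
    rwa [← h2, ← h4] at h5
  · rw [bottom_shiftDiag_of_lt (by omega) h4]
  · exact bottom_shiftDiag_of_eq (i := Fin.cast he b.2.2) (h2.symm.trans he) h3.le h4

theorem JumpLeadsTo.not_blocked {n : ℕ} {a : Pattern n × Σ l : Fin n, Fin (l + 1)}
    {b : Pattern n × Σ m : Fin (n + 1), Fin m} (h : JumpLeadsTo a b) :
    ¬ Blocked a.1.1 a.2.1 a.2.2 := by
  obtain ⟨d, h1, h2, h3, h4⟩ := h
  exact not_blocked_of_shiftDiag h3 (h4 ▸ b.1.2) h1 rfl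

theorem JumpLeadsTo.attempt_eq {n : ℕ} {a : Pattern n × Σ l : Fin n, Fin (l + 1)}
    {b : Pattern n × Σ m : Fin (n + 1), Fin m} (h : JumpLeadsTo a b) :
    attempt a.1 a.2.1 a.2.2 = b.1 := by
  have hb := h.not_blocked
  obtain ⟨d, h1, h2, h3, h4⟩ := h
  rw [attempt, dif_neg hb]
  exact Subtype.ext ((moved_eq_shiftDiag h3 h1).trans h4.symm)

theorem exists_jumpLeadsTo {n : ℕ} {a : Pattern n × Σ l : Fin n, Fin (l + 1)}
    (ha : ¬ Blocked a.1.1 a.2.1 a.2.2) : ∃ b, JumpLeadsTo a b := by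
  obtain ⟨x, l, j⟩ := a
  have hl := l.2
  have hj := j.2
  obtain ⟨i, hi⟩ := exists_isPushedChain x.2 (d := l + 1 - j) (j := j) (by omega) (by omega)
  have h1 := hi.add_le
  have h2 : (l : ℕ) + 1 = l + 1 - j + j := by omega
  refine ⟨⟨attempt x l j, ⟨l + 1 - j + i, by omega⟩, ⟨i, by simp only; omega⟩⟩, l + 1 - j, h2,
    rfl, hi, ?_⟩
  rw [attempt, dif_neg ha]
  exact moved_eq_shiftDiag hi h2

/-- The jump is undone by following level particles back along the diagonal until a strict gap or
index 0, and lowering that segment by one. -/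
theorem exists_jumpLeadsTo_of_isJumpEnd {n : ℕ} {z : Fin n → ℤ} (hz : Monotone z)
    {b : Pattern n × Σ m : Fin (n + 1), Fin m} (hb : IsJumpEnd z b) :
    ∃ a, JumpLeadsTo a b ∧ (bottom a.1).1 = z := by
  obtain ⟨y, m, i⟩ := b
  have hm := m.2
  have hi := i.2
  obtain ⟨d, hd⟩ : ∃ d : ℕ, (m : ℕ) = d + i := ⟨m - i, by omega⟩
  have hd0 : 0 < d := by omega
  have hr : Retractable y.1 (d + i) i := by
    have hb1 := hb.1
    have hb2 := hb.2
    simp only at hb1 hb2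
    rw [← hd]
    refine ⟨fun h => (hb1 h).1, fun h0 => ?_⟩
    -- Above the last row the gap to the left neighbour follows from the strict inequality and
    -- interlacing; in the last row it comes from `z` being increasing and `y` having bottom row `z
    -- + e_i`.
    rcases (Nat.lt_succ_iff.1 hm).lt_or_eq with h | h
    · have h1 := (hb1 h).1
      have h2 := (interlaced_iff.1 y.2 m (i - 1) h (by omega)).2
      rw [Nat.sub_add_cancel h0] at h2
      omega
    · have h1 := congrFun (hb2 h)
      have h2 := h1 ⟨i - 1, by omega⟩
      have h3 := h1 (Fin.cast h i)
      rw [bottom_apply, Pi.add_apply, Pi.single_eq_of_ne, add_zero] at h2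
      · rw [bottom_apply, Pi.add_apply, Pi.single_eq_same] at h3
        have h4 : z ⟨i - 1, by omega⟩ ≤ z (Fin.cast h i) := hz (by
          rw [Fin.le_def]; simp only [Fin.val_cast]; omega)
        simp only [Fin.val_cast] at h2 h3
        have e : ∀ a, entry y.1 m a = entry y.1 n a := fun a => by rw [h]
        rw [e, e]
        omega
      · rw [Ne, Fin.ext_iff]
        simp only [Fin.val_cast]
        omega
  obtain ⟨j, hj⟩ := exists_isPullingChain y.2 hd0 (i := i) (by omega)
  have hji := hj.le
  let x : Pattern n := ⟨_, interlaced_shiftDiag_neg y.2 hd0 (by omega) hj hr⟩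
  have hyx : y.1 = shiftDiag x.1 1 d j i := (shiftDiag_shiftDiag_neg y.1 1 d j i).symm
  have hx := isPushedChain_shiftDiag_neg y.2 hd0 (by omega) hj
  refine ⟨⟨x, ⟨d + j - 1, by omega⟩, ⟨j, by simp only; omega⟩⟩,
    ⟨d, by simp only; omega, hd, hx, hyx⟩, ?_⟩
  rcases (Nat.lt_succ_iff.1 hm).lt_or_eq with h | h
  · rw [← (hb.1 h).2, ← bottom_shiftDiag_of_lt (by omega) hyx]
  · have h1 := bottom_shiftDiag_of_eq (i := Fin.cast h i) (hd.symm.trans h) hji hyx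
    exact add_right_cancel (h1.symm.trans (hb.2 h))

theorem JumpLeadsTo.left_unique {n : ℕ} {a a' : Pattern n × Σ l : Fin n, Fin (l + 1)}
    {b : Pattern n × Σ m : Fin (n + 1), Fin m} (h : JumpLeadsTo a b) (h' : JumpLeadsTo a' b) :
    a = a' := by
  obtain ⟨d, h1, h2, h3, h4⟩ := h
  obtain ⟨d', h1', h2', h3', h4'⟩ := h'
  obtain rfl : d = d' := by omega
  obtain ⟨x, l, j⟩ := a
  obtain ⟨x', l', j'⟩ := a'
  simp only at *
  have hj := h3.start_unique x.2 x'.2 h3' h4 h4'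
  obtain rfl : l = l' := Fin.ext (by omega)
  obtain rfl : j = j' := Fin.ext hj
  obtain rfl : x = x' := Subtype.ext (shiftDiag_injective (h4.symm.trans h4'))
  rfl

theorem JumpLeadsTo.right_unique {n : ℕ} {a : Pattern n × Σ l : Fin n, Fin (l + 1)}
    {b b' : Pattern n × Σ m : Fin (n + 1), Fin m} (h : JumpLeadsTo a b) (h' : JumpLeadsTo a b') :
    b = b' := by
  obtain ⟨d, h1, h2, h3, h4⟩ := h
  obtain ⟨d', h1', h2', h3', h4'⟩ := h'
  obtain rfl : d = d' := by omega
  obtain ⟨y, m, i⟩ := b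
  obtain ⟨y', m', i'⟩ := b'
  simp only at *
  have hi := h3.unique h3'
  obtain rfl : m = m' := Fin.ext (by omega)
  obtain rfl : i = i' := Fin.ext hi
  obtain rfl : y = y' := Subtype.ext (h4.trans h4'.symm)
  rfl

theorem JumpLeadsTo.weight_eq {n : ℕ} {q : Fin n → ℝ} (hq : ∀ i, 0 < q i)
    {a : Pattern n × Σ l : Fin n, Fin (l + 1)} {b : Pattern n × Σ m : Fin (n + 1), Fin m}
    (h : JumpLeadsTo a b) :
    weight q a.1 * q a.2.1 = weight q b.1 * nextRate q b.2.1 := by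
  obtain ⟨d, h1, h2, h3, h4⟩ := h
  exact (weight_shiftDiag hq h3.pos h3.le a.2.1 h1 b.2.1 h2 h4).symm

/-! ### Summation over all attempts, and the Pieri rule. -/

open Classical in
theorem sum_unblocked {n : ℕ} {q : Fin n → ℝ} (hq : ∀ i, 0 < q i) {z : Fin n → ℤ}
    (hz : Monotone z) (f : Pattern n → ℝ) :
    ∑ x ∈ (finite_bottom z).toFinset, ∑ l : Fin n, ∑ j : Fin (l + 1),
      (if Blocked x.1 l j then 0 else weight q x * q l * f (attempt x l j)) =
    ∑ y ∈ (finite_bottom z).toFinset, ∑ l : Fin n, ∑ i : Fin l,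
        (if entry y.1 (l + 1) i < entry y.1 l i then weight q y * q l * f y else 0) +
      ∑ i, ∑ y ∈ (finite_bottom (z + Pi.single i 1)).toFinset, weight q y * f y := by
  -- A finite set containing every pattern reachable by one jump, so that the ends are indexed by a
  -- finite product.
  let U : Finset (Pattern n) := (finite_bottom z).toFinset ∪
    Finset.univ.biUnion fun i => (finite_bottom (z + Pi.single i 1)).toFinset
  have key : ∑ a ∈ ((finite_bottom z).toFinset ×ˢ
        (Finset.univ : Finset (Σ l : Fin n, Fin (l + 1)))).filter
          (fun a => ¬ Blocked a.1.1 a.2.1 a.2.2),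
        weight q a.1 * q a.2.1 * f (attempt a.1 a.2.1 a.2.2) =
      ∑ b ∈ (U ×ˢ (Finset.univ : Finset (Σ m : Fin (n + 1), Fin m))).filter
          (fun b => IsJumpEnd z b), weight q b.1 * nextRate q b.2.1 * f b.1 := by
    refine Finset.sum_eq_sum_of_rel JumpLeadsTo ?_ ?_ (fun _ _ _ _ _ _ h h' => h.left_unique h')
      (fun _ _ _ _ _ _ h h' => h.right_unique h')
      (fun _ _ _ _ h => by rw [h.weight_eq hq, h.attempt_eq])
    · intro a ha
      simp only [Finset.mem_filter, Finset.mem_product, mem_fiber, Finset.mem_univ,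
        and_true] at ha
      obtain ⟨b, hb⟩ := exists_jumpLeadsTo ha.2
      have hend := ha.1 ▸ hb.isJumpEnd
      refine ⟨b, ?_, hb⟩
      simp only [U, Finset.mem_filter, Finset.mem_product, Finset.mem_union, mem_fiber,
        Finset.mem_univ, and_true, Finset.mem_biUnion, true_and]
      refine ⟨?_, hend⟩
      rcases (Nat.lt_succ_iff.1 b.2.1.2).lt_or_eq with h | h
      · exact Or.inl (hend.1 h).2
      · exact Or.inr ⟨_, hend.2 h⟩
    · intro b hb
      obtain ⟨a, ha, haz⟩ := exists_jumpLeadsTo_of_isJumpEnd hz (Finset.mem_filter.1 hb).2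
      refine ⟨a, ?_, ha⟩
      simp only [Finset.mem_filter, Finset.mem_product, mem_fiber, Finset.mem_univ, and_true]
      exact ⟨haz, ha.not_blocked⟩
  -- The ends split into those above the last row, with bottom row `z`, and those in the last row,
  -- with bottom row `z + e_i`.
  rw [Finset.sum_filter, Finset.sum_filter, Finset.sum_product, Finset.sum_product_right,
    Fintype.sum_sigma, Fin.sum_univ_castSucc] at key
  simp only [Fintype.sum_sigma, ite_not] at key
  rw [key]
  congr 1
  · rw [Finset.sum_comm]
    refine Finset.sum_congr rfl fun l _ => ?_
    refine Eq.trans (Finset.sum_congr rfl fun i _ => ?_) Finset.sum_comm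
    have hsub : (finite_bottom z).toFinset ⊆ U := Finset.subset_union_left
    rw [← Finset.sum_subset hsub]
    · refine Finset.sum_congr rfl fun y hy => ?_
      rw [mem_fiber] at hy
      have : nextRate q l.castSucc = q l := by
        rw [nextRate, dif_pos (by simp)]
        rfl
      rw [this]
      refine if_congr ?_ rfl rfl
      have hl := l.2
      simp only [IsJumpEnd, Fin.val_castSucc, hl, hy, and_true, forall_const]
      exact and_iff_left fun h => absurd h hl.ne
    · intro y _ hy
      rw [mem_fiber] at hy
      exact if_neg fun h => hy (h.1 l.2).2
  · suffices hlast : ∀ i : Fin n,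
        ∑ y ∈ U, (if IsJumpEnd z (y, ⟨Fin.last n, i⟩) then
          weight q y * nextRate q (Fin.last n) * f y else 0) =
        ∑ y ∈ (finite_bottom (z + Pi.single i 1)).toFinset, weight q y * f y from
      Finset.sum_congr rfl fun i _ => hlast i
    intro i
    have hsub : (finite_bottom (z + Pi.single i 1)).toFinset ⊆ U := fun y hy =>
      Finset.mem_union_right _ (Finset.mem_biUnion.2 ⟨i, Finset.mem_univ i, hy⟩)
    rw [← Finset.sum_subset hsub]
    · refine Finset.sum_congr rfl fun y hy => ?_
      rw [mem_fiber] at hy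
      have : nextRate q (Fin.last n) = 1 := by
        rw [nextRate, dif_neg (by simp)]
      rw [this, mul_one, if_pos]
      exact ⟨fun h => absurd h (lt_irrefl n), fun _ => hy⟩
    · intro y _ hy
      rw [mem_fiber] at hy
      exact if_neg fun h => hy (h.2 rfl)

open Classical in
-- Unblocked jumps contribute the strict inequalities between rows `l` and `l + 1`, blocked attempts
-- the equalities, at the same rate `q l`. Together they count all `l` particles of row `l`,
-- whatever the pattern.
theorem sum_attempt {n : ℕ} {q : Fin n → ℝ} (hq : ∀ i, 0 < q i) {z : Fin n → ℤ}
    (hz : Monotone z) (f : Pattern n → ℝ) :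
    ∑ x ∈ (finite_bottom z).toFinset, weight q x *
        ∑ l : Fin n, ∑ j : Fin (l + 1), q l * f (attempt x l j) =
    (∑ i, ∑ y ∈ (finite_bottom (z + Pi.single i 1)).toFinset, weight q y * f y) +
      (∑ l : Fin n, (l : ℝ) * q l) * ∑ y ∈ (finite_bottom z).toFinset, weight q y * f y := by
  have h1 : ∀ x : Pattern n, weight q x * ∑ l : Fin n, ∑ j : Fin (l + 1), q l * f (attempt x l j) =
      ∑ l : Fin n, ∑ j : Fin (l + 1),
        (if Blocked x.1 l j then 0 else weight q x * q l * f (attempt x l j)) +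
      ∑ l : Fin n, ∑ i : Fin l,
        (if entry x.1 (l + 1) i < entry x.1 l i then 0 else weight q x * q l * f x) := by
    intro x
    rw [Finset.mul_sum, ← Finset.sum_add_distrib]
    refine Finset.sum_congr rfl fun l _ => ?_
    have h2 : ∑ i : Fin l,
        (if entry x.1 (l + 1) i < entry x.1 l i then 0 else weight q x * q l * f x) =
        ∑ j : Fin (l + 1), (if Blocked x.1 l j then weight q x * q l * f x else 0) := by
      rw [Fin.sum_univ_castSucc, if_neg (c := Blocked x.1 l (Fin.last _))]
      · rw [add_zero]
        refine Finset.sum_congr rfl fun i _ => ?_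
        have h3 : entry x.1 (l + 1) i ≤ entry x.1 l i := (interlaced_iff.1 x.2 l i l.2 i.2).1
        simp only [blocked_iff, Fin.val_castSucc, i.2, true_and]
        split_ifs <;> first | rfl | omega
      · simp [blocked_iff]
    rw [h2, Finset.mul_sum, ← Finset.sum_add_distrib]
    refine Finset.sum_congr rfl fun j _ => ?_
    split_ifs with hb
    · rw [attempt, dif_pos hb]
      ring
    · ring
  simp only [h1]
  rw [Finset.sum_add_distrib, sum_unblocked hq hz, add_right_comm, ← Finset.sum_add_distrib,
    add_comm, Finset.mul_sum]
  congr 1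
  refine Finset.sum_congr rfl fun y _ => ?_
  rw [← Finset.sum_add_distrib, Finset.sum_mul]
  refine Finset.sum_congr rfl fun l _ => ?_
  rw [← Finset.sum_add_distrib]
  trans ∑ i : Fin l, weight q y * q l * f y
  · refine Finset.sum_congr rfl fun i _ => ?_
    split_ifs <;> ring
  · rw [Finset.sum_const, Finset.card_univ, Fintype.card_fin, nsmul_eq_mul]
    ring

/-- The Pieri rule for the multiplication by the first power sum. -/
theorem sum_schur_add_single {n : ℕ} {q : Fin n → ℝ} (hq : ∀ i, 0 < q i) {z : Fin n → ℤ}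
    (hz : Monotone z) :
    ∑ i, schur q (z + Pi.single i 1) = (∑ i, q i) * schur q z := by
  have h := sum_attempt hq hz fun _ => 1
  simp only [mul_one] at h
  have h1 : ∑ l : Fin n, ∑ _j : Fin (l + 1), q l = ∑ l : Fin n, (l : ℝ) * q l + ∑ l, q l := by
    rw [← Finset.sum_add_distrib]
    refine Finset.sum_congr rfl fun l _ => ?_
    rw [Finset.sum_const, Finset.card_univ, Fintype.card_fin, nsmul_eq_mul]
    push_cast
    ring
  rw [h1, ← Finset.sum_mul] at h
  simp only [schur]
  linarith

theorem fiber_nonempty {n : ℕ} {z : Fin n → ℤ} (hz : Monotone z) :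
    (finite_bottom z).toFinset.Nonempty := by
  -- The pattern whose rows are the initial segments of `z`.
  refine ⟨⟨fun k i => z ⟨i, i.2.trans_le (Nat.lt_succ_iff.1 k.2)⟩, fun k i => ⟨?_, ?_⟩⟩, ?_⟩
  · exact hz (by rw [Fin.le_def]; simp)
  · exact hz (by rw [Fin.le_def]; simp)
  · rw [mem_fiber]
    rfl

theorem fiber_eq_empty {n : ℕ} {z : Fin n → ℤ} (hz : ¬ Monotone z) :
    (finite_bottom z).toFinset = ∅ := by
  refine Finset.eq_empty_of_forall_notMem fun x hx => hz ?_
  rw [← mem_fiber.1 hx]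
  exact (bottom x).2

theorem schur_pos {n : ℕ} {q : Fin n → ℝ} (hq : ∀ i, 0 < q i) {z : Fin n → ℤ}
    (hz : Monotone z) : 0 < schur q z :=
  Finset.sum_pos (fun x _ => weight_pos hq x) (fiber_nonempty hz)

theorem schur_nonneg {n : ℕ} {q : Fin n → ℝ} (hq : ∀ i, 0 < q i) (z : Fin n → ℤ) :
    0 ≤ schur q z :=
  Finset.sum_nonneg fun x _ => (weight_pos hq x).le

theorem schur_of_not_monotone {n : ℕ} {q : Fin n → ℝ} {z : Fin n → ℤ} (hz : ¬ Monotone z) :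
    schur q z = 0 := by
  rw [schur, fiber_eq_empty hz, Finset.sum_empty]

theorem schurRate_eq {n : ℕ} (q : Fin n → ℝ) (x : Weyl n) (i : Fin n) :
    schurRate q x i = schur q (x.1 + Pi.single i 1) / schur q x.1 := by
  rw [schurRate]
  split_ifs with h
  · rfl
  · rw [schur_of_not_monotone h, zero_div]

/-! ### The generators and the intertwining -/

/-- The mean of `f` under the distribution on the patterns with bottom row `z`. -/
noncomputable def fiberMean {n : ℕ} (q : Fin n → ℝ) (f : Pattern n → ℝ) (z : Fin n → ℤ) : ℝ :=
  (∑ x ∈ (finite_bottom z).toFinset, weight q x * f x) / schur q z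

/-- The generator of the process on patterns. -/
noncomputable def patternGen {n : ℕ} (q : Fin n → ℝ) (f : Pattern n → ℝ) (x : Pattern n) : ℝ :=
  ∑ l : Fin n, ∑ j : Fin (l + 1), q l * (f (attempt x l j) - f x)

/-- The generator of the process on the Weyl chamber. -/
noncomputable def weylGen {n : ℕ} (q : Fin n → ℝ) (g : (Fin n → ℤ) → ℝ) (z : Fin n → ℤ) : ℝ :=
  ∑ i : Fin n, schur q (z + Pi.single i 1) / schur q z * (g (z + Pi.single i 1) - g z)

theorem fiberMean_of_not_monotone {n : ℕ} {q : Fin n → ℝ} {f : Pattern n → ℝ} {z : Fin n → ℤ}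
    (hz : ¬ Monotone z) : fiberMean q f z = 0 := by
  rw [fiberMean, schur_of_not_monotone hz, div_zero]

theorem schur_mul_fiberMean {n : ℕ} {q : Fin n → ℝ} (hq : ∀ i, 0 < q i) (f : Pattern n → ℝ)
    (z : Fin n → ℤ) :
    schur q z * fiberMean q f z = ∑ x ∈ (finite_bottom z).toFinset, weight q x * f x := by
  by_cases hz : Monotone z
  · exact mul_div_cancel₀ _ (schur_pos hq hz).ne'
  · rw [schur_of_not_monotone hz, fiber_eq_empty hz, zero_mul, Finset.sum_empty]

/-- By the Pieri rule the total jump rate does not depend on `z`; hence the generator is bounded. -/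
theorem sum_rate {n : ℕ} {q : Fin n → ℝ} (hq : ∀ i, 0 < q i) {z : Fin n → ℤ} (hz : Monotone z) :
    ∑ i, schur q (z + Pi.single i 1) / schur q z = ∑ i, q i := by
  rw [← Finset.sum_div, sum_schur_add_single hq hz, mul_div_cancel_right₀ _ (schur_pos hq hz).ne']

/-- The intertwining of the two generators. -/
theorem fiberMean_patternGen {n : ℕ} {q : Fin n → ℝ} (hq : ∀ i, 0 < q i) (f : Pattern n → ℝ)
    (z : Fin n → ℤ) : fiberMean q (patternGen q f) z = weylGen q (fiberMean q f) z := by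
  by_cases hz : Monotone z
  swap
  -- Outside the chamber both sides are quotients by `schur q z = 0`, hence zero by convention.
  · simp [fiberMean, weylGen, schur_of_not_monotone hz]
  have hS := (schur_pos hq hz).ne'
  have h1 : ∀ x : Pattern n, weight q x * patternGen q f x =
      weight q x * (∑ l : Fin n, ∑ j : Fin (l + 1), q l * f (attempt x l j)) -
        (∑ l : Fin n, ((l : ℝ) + 1) * q l) * (weight q x * f x) := by
    intro x
    have h2 : ∑ l : Fin n, ∑ _j : Fin (l + 1), q l * f x =
        (∑ l : Fin n, ((l : ℝ) + 1) * q l) * f x := by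
      rw [Finset.sum_mul]
      refine Finset.sum_congr rfl fun l _ => ?_
      rw [Finset.sum_const, Finset.card_univ, Fintype.card_fin, nsmul_eq_mul]
      push_cast
      ring
    simp only [patternGen, mul_sub, Finset.sum_sub_distrib]
    rw [h2]
    ring
  have h3 : weylGen q (fiberMean q f) z =
      (∑ i, ∑ y ∈ (finite_bottom (z + Pi.single i 1)).toFinset, weight q y * f y) / schur q z -
        (∑ i, q i) * fiberMean q f z := by
    simp only [weylGen, mul_sub, Finset.sum_sub_distrib]
    rw [← Finset.sum_mul, sum_rate hq hz, Finset.sum_div]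
    congr 1
    refine Finset.sum_congr rfl fun i _ => ?_
    rw [div_mul_eq_mul_div, schur_mul_fiberMean hq]
  rw [h3, fiberMean, fiberMean]
  simp only [h1]
  rw [Finset.sum_sub_distrib, sum_attempt hq hz, ← Finset.mul_sum]
  simp only [add_mul, one_mul, Finset.sum_add_distrib]
  field_simp
  ring

open Classical in
theorem sum_patternQ_mul {n : ℕ} (q : Fin n → ℝ) (x : Pattern n) {F : Finset (Pattern n)}
    (hx : x ∈ F) (hF : ∀ l j, attempt x l j ∈ F) (g : Pattern n → ℝ) :
    ∑ y ∈ F, patternQ q x y * g y = patternGen q g x := by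
  simp only [patternQ, Finset.sum_mul]
  rw [Finset.sum_comm]
  refine Finset.sum_congr rfl fun l _ => ?_
  rw [Finset.sum_comm]
  refine Finset.sum_congr rfl fun j _ => ?_
  simp only [mul_assoc, sub_mul, ite_mul, one_mul, zero_mul]
  rw [← Finset.mul_sum, Finset.sum_sub_distrib, Finset.sum_ite_eq', Finset.sum_ite_eq',
    if_pos hx, if_pos (hF l j)]

theorem patternGen_sum {n : ℕ} (q : Fin n → ℝ) {ι : Type*} (s : Finset ι) (a : ι → ℝ)
    (f : ι → Pattern n → ℝ) (x : Pattern n) :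
    patternGen q (fun x => ∑ y ∈ s, a y * f y x) x = ∑ y ∈ s, a y * patternGen q (f y) x := by
  simp only [patternGen, Finset.mul_sum]
  rw [Finset.sum_comm]
  refine Finset.sum_congr rfl fun l _ => ?_
  rw [Finset.sum_comm]
  refine Finset.sum_congr rfl fun j _ => ?_
  rw [← Finset.sum_sub_distrib, Finset.mul_sum]
  exact Finset.sum_congr rfl fun y _ => by ring

theorem abs_fiberMean_le {n : ℕ} {q : Fin n → ℝ} (hq : ∀ i, 0 < q i) {f : Pattern n → ℝ} {B : ℝ}
    (hB : 0 ≤ B) (hf : ∀ x, |f x| ≤ B) (z : Fin n → ℤ) : |fiberMean q f z| ≤ B := by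
  by_cases hz : Monotone z
  · have hS := schur_pos hq hz
    rw [fiberMean, abs_div, abs_of_pos hS, div_le_iff₀ hS]
    refine (Finset.abs_sum_le_sum_abs _ _).trans ?_
    rw [schur, Finset.mul_sum]
    refine Finset.sum_le_sum fun x _ => ?_
    rw [abs_mul, abs_of_pos (weight_pos hq x), mul_comm]
    exact mul_le_mul_of_nonneg_right (hf x) (weight_pos hq x).le
  · rwa [fiberMean_of_not_monotone hz, abs_zero]

theorem abs_weylGen_le {n : ℕ} {q : Fin n → ℝ} (hq : ∀ i, 0 < q i) {g : (Fin n → ℤ) → ℝ} {B : ℝ}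
    (hg : ∀ z, |g z| ≤ B) (z : Fin n → ℤ) : |weylGen q g z| ≤ (∑ i, q i) * 2 * B := by
  have hB : 0 ≤ B := (abs_nonneg _).trans (hg z)
  by_cases hz : Monotone z
  · rw [← sum_rate hq hz, mul_assoc, Finset.sum_mul]
    refine (Finset.abs_sum_le_sum_abs _ _).trans (Finset.sum_le_sum fun i _ => ?_)
    have h0 := div_nonneg (schur_nonneg hq (z + Pi.single i 1)) (schur_nonneg hq z)
    rw [abs_mul, abs_of_nonneg h0]
    refine mul_le_mul_of_nonneg_left ?_ h0
    refine (abs_sub _ _).trans ?_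
    linarith [hg (z + Pi.single i 1), hg z]
  · have h0 : weylGen q g z = 0 := by simp [weylGen, schur_of_not_monotone hz]
    rw [h0, abs_zero]
    exact mul_nonneg (mul_nonneg (Finset.sum_nonneg fun i _ => (hq i).le) zero_le_two) hB

/-! ### From generators to transition functions. -/

theorem hasDerivWithinAt_patternGen {n : ℕ} {q : Fin n → ℝ} {p : ℝ≥0 → Pattern n → Pattern n → ℝ}
    (hp : IsTransitionFunction (patternQ q) p) (x y : Pattern n) {t : ℝ} (ht : 0 ≤ t) :
    HasDerivWithinAt (fun t : ℝ => p t.toNNReal x y)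
      (patternGen q (fun x => p t.toNNReal x y) x) (Set.Ici t) t := by
  classical
  let F : Finset (Pattern n) :=
    insert x (Finset.univ.image fun a : Σ l : Fin n, Fin (l + 1) => attempt x a.1 a.2)
  have hx : x ∈ F := Finset.mem_insert_self _ _
  have hF : ∀ l j, attempt x l j ∈ F := fun l j =>
    Finset.mem_insert_of_mem (Finset.mem_image.2 ⟨⟨l, j⟩, Finset.mem_univ _, rfl⟩)
  rw [← sum_patternQ_mul q x hx hF]
  refine hp.hasDerivWithinAt_backward hx ?_ y ht
  have := sum_patternQ_mul q x hx hF fun _ => 1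
  simpa [patternGen] using this

/-- The transition function of the bottom row. -/
noncomputable def bottomTransition {n : ℕ} (q : Fin n → ℝ) (p : ℝ≥0 → Pattern n → Pattern n → ℝ)
    (t : ℝ≥0) (z z' : Weyl n) : ℝ :=
  fiberMean q (fun x => ∑ y ∈ (finite_bottom z'.1).toFinset, p t x y) z.1

/-- The intertwining of the two transition functions. -/
theorem fiberMean_transition {n : ℕ} {q : Fin n → ℝ} (hq : ∀ i, 0 < q i)
    {p : ℝ≥0 → Pattern n → Pattern n → ℝ} (hp : IsTransitionFunction (patternQ q) p)
    (t : ℝ≥0) (z : Weyl n) (y : Pattern n) :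
    fiberMean q (fun x => p t x y) z.1 =
      bottomTransition q p t z (bottom y) * (weight q y / schur q (bottom y).1) := by
  classical
  have hS := schur_pos hq (bottom y).2
  set s := (finite_bottom (bottom y).1).toFinset with hs
  set c := weight q y / schur q (bottom y).1 with hc
  have hy : y ∈ s := mem_fiber.2 rfl
  -- The coefficients compare the indicator of `y` with its conditional probability `c` times the
  -- indicator of its fibre; the claim is that the corresponding mean of `p t` vanishes for all
  -- times.
  let a : Pattern n → ℝ := fun y' => (if y' = y then 1 else 0) - c
  have hsplit : ∀ g : Pattern n → ℝ, ∑ y' ∈ s, a y' * g y' = g y - c * ∑ y' ∈ s, g y' := by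
    intro g
    simp only [a, sub_mul, ite_mul, one_mul, zero_mul, Finset.sum_sub_distrib]
    rw [Finset.sum_ite_eq', if_pos hy, Finset.mul_sum]
  have key := eq_zero_of_linear_evolution (S := Fin n → ℤ)
    (f := fun t z => fiberMean q (fun x => ∑ y' ∈ s, a y' * p t.toNNReal x y') z)
    (f' := fun t z => weylGen q (fiberMean q fun x => ∑ y' ∈ s, a y' * p t.toNNReal x y') z)
    (C := (∑ i, q i) * 2) (M := ∑ y' ∈ s, |a y'|) ?_ ?_ ?_ ?_ ?_ t.2 z.1
  · have hsplit' : ∀ x : Pattern n, ∑ y' ∈ s, a y' * p (t : ℝ).toNNReal x y' =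
        p t x y - c * ∑ y' ∈ s, p t x y' := by
      intro x
      rw [Real.toNNReal_coe]
      exact hsplit _
    simp only [NNReal.val_eq_coe, hsplit'] at key
    rw [bottomTransition, ← sub_eq_zero, ← key]
    simp only [fiberMean, ← hs, mul_sub, Finset.sum_sub_distrib, sub_div]
    congr 1
    rw [div_mul_eq_mul_div, Finset.sum_mul]
    congr 1
    exact Finset.sum_congr rfl fun x _ => by ring
  · intro z
    simp only [fiberMean]
    refine Continuous.div_const (continuous_finsetSum _ fun x _ => ?_) _
    exact continuous_const.mul (continuous_finsetSum _ fun y' _ =>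
      continuous_const.mul (hp.continuous_time x y'))
  · intro z t ht
    rw [← fiberMean_patternGen hq]
    simp only [fiberMean]
    refine HasDerivWithinAt.div_const (HasDerivWithinAt.fun_sum fun x _ => ?_) _
    rw [patternGen_sum q s a (fun y' x => p t.toNNReal x y')]
    exact HasDerivWithinAt.const_mul _ (HasDerivWithinAt.fun_sum fun y' _ =>
      HasDerivWithinAt.const_mul _ (hasDerivWithinAt_patternGen hp x y' ht))
  · intro t B _ hB z
    exact abs_weylGen_le hq hB z
  · intro z
    have h0 : ∀ x : Pattern n, ∑ y' ∈ s, a y' * p (0 : ℝ).toNNReal x y' =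
        if x ∈ s then a x else 0 := by
      intro x
      simp only [Real.toNNReal_zero, hp.zero, mul_ite, mul_one, mul_zero]
      exact Finset.sum_ite_eq' s x a
    simp only [h0]
    rw [fiberMean, div_eq_zero_iff]
    left
    by_cases hz : z = (bottom y).1
    · subst hz
      -- At time 0 on the fibre of `y`, the weighted sum of `a` is `weight q y - c * schur q (bottom
      -- y).1 = 0`.
      rw [← hs, Finset.sum_congr rfl fun x hx => by rw [if_pos hx]]
      have := hsplit (weight q)
      rw [Finset.sum_congr rfl fun x _ => mul_comm _ _, this, hc, ← schur]
      field_simp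
      simp
    · refine Finset.sum_eq_zero fun x hx => ?_
      rw [if_neg, mul_zero]
      rw [hs, mem_fiber, mem_fiber.1 hx]
      exact hz
  · intro t z
    refine abs_fiberMean_le hq (Finset.sum_nonneg fun _ _ => abs_nonneg _) (fun x => ?_) z
    refine (Finset.abs_sum_le_sum_abs _ _).trans (Finset.sum_le_sum fun y' _ => ?_)
    rw [abs_mul, abs_of_nonneg (hp.nonneg _ _ _)]
    exact mul_le_of_le_one_right (abs_nonneg _) (hp.le_one _ _ _)

theorem hasSum_fiber {n : ℕ} {g : Pattern n → ℝ} {a : ℝ} (h : HasSum g a) :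
    HasSum (fun z : Weyl n => ∑ y ∈ (finite_bottom z.1).toFinset, g y) a := by
  rw [← (Equiv.sigmaFiberEquiv (bottom (n := n))).hasSum_iff] at h
  refine h.sigma fun z => ?_
  have h1 := (finite_bottom z.1).toFinset.hasSum g
  let e : {y : Pattern n // bottom y = z} ≃ {y // y ∈ (finite_bottom z.1).toFinset} :=
    Equiv.subtypeEquivRight fun y => by rw [mem_fiber, Subtype.ext_iff]
  exact e.hasSum_iff.2 h1

theorem hasSum_fiberMean {n : ℕ} {q : Fin n → ℝ} {ι : Type*} {f : ι → Pattern n → ℝ}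
    {a : Pattern n → ℝ} (h : ∀ x, HasSum (fun i => f i x) (a x)) (z : Fin n → ℤ) :
    HasSum (fun i => fiberMean q (f i) z) (fiberMean q a z) :=
  (hasSum_sum fun x _ => (h x).mul_left (weight q x)).div_const _

theorem fiberMean_const {n : ℕ} {q : Fin n → ℝ} (hq : ∀ i, 0 < q i) (c : ℝ) {z : Fin n → ℤ}
    (hz : Monotone z) : fiberMean q (fun _ => c) z = c := by
  rw [fiberMean, ← Finset.sum_mul, ← schur, mul_div_cancel_left₀ _ (schur_pos hq hz).ne']

theorem fiberMean_bottom_eq {n : ℕ} {q : Fin n → ℝ} (hq : ∀ i, 0 < q i) (z' : Weyl n)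
    (z : Fin n → ℤ) [∀ x : Pattern n, Decidable (bottom x = z')] [Decidable (z = z'.1)] :
    fiberMean q (fun x => if bottom x = z' then 1 else 0) z = if z = z'.1 then 1 else 0 := by
  have h1 : fiberMean q (fun x => if bottom x = z' then 1 else 0) z =
      fiberMean q (fun _ => if z = z'.1 then 1 else 0) z := by
    rw [fiberMean, fiberMean]
    congr 1
    refine Finset.sum_congr rfl fun x hx => ?_
    rw [mem_fiber] at hx
    congr 1
    exact if_congr (by rw [Subtype.ext_iff, hx]) rfl rfl
  rw [h1]
  by_cases hz : Monotone z
  · exact fiberMean_const hq _ hz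
  · rw [fiberMean_of_not_monotone hz, if_neg]
    rintro rfl
    exact hz z'.2

theorem sum_fiber_ite {n : ℕ} (x : Pattern n) (z : Weyl n) [∀ y : Pattern n, Decidable (y = x)]
    [Decidable (bottom x = z)] :
    ∑ y ∈ (finite_bottom z.1).toFinset, (if y = x then (1 : ℝ) else 0) =
      if bottom x = z then 1 else 0 := by
  split_ifs with h
  · rw [Finset.sum_eq_single_of_mem x (mem_fiber.2 (congrArg Subtype.val h))
      fun y _ hy => if_neg hy, if_pos rfl]
  · refine Finset.sum_eq_zero fun y hy => if_neg ?_
    rintro rfl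
    exact h (Subtype.ext (mem_fiber.1 hy))

theorem isTransitionFunction_bottomTransition {n : ℕ} {q : Fin n → ℝ} (hq : ∀ i, 0 < q i)
    {p : ℝ≥0 → Pattern n → Pattern n → ℝ} (hp : IsTransitionFunction (patternQ q) p) :
    IsTransitionFunction (weylQ q) (bottomTransition q p) where
  nonneg t z z' := div_nonneg (Finset.sum_nonneg fun x _ => mul_nonneg (weight_pos hq x).le
    (Finset.sum_nonneg fun y _ => hp.nonneg t x y)) (schur_nonneg hq _)
  sum_one t z := by
    have h := hasSum_fiberMean (q := q) (fun x => hasSum_fiber (hp.sum_one t x)) z.1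
    rwa [fiberMean_const hq _ z.2] at h
  zero z z' := by
    classical
    have h : ∀ x : Pattern n, ∑ y ∈ (finite_bottom z'.1).toFinset, p 0 x y =
        if bottom x = z' then 1 else 0 := fun x => by
      simp only [hp.zero]
      convert sum_fiber_ite x z'
    simp only [bottomTransition, h]
    rw [fiberMean_bottom_eq hq]
    simp only [Subtype.ext_iff, eq_comm]
  chapman_kolmogorov s t z z' := by
    have h1 : HasSum (fun x' => fiberMean q (fun x => p s x x') z.1 *
        ∑ y ∈ (finite_bottom z'.1).toFinset, p t x' y) (bottomTransition q p (s + t) z z') := by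
      have h2 := hasSum_fiberMean (q := q) (fun x => hasSum_sum
        fun y (_ : y ∈ (finite_bottom z'.1).toFinset) => hp.chapman_kolmogorov s t x y) z.1
      refine Eq.subst (motive := fun f => HasSum f _) (funext fun x' => ?_) h2
      simp only [← Finset.mul_sum, fiberMean, div_mul_eq_mul_div, Finset.sum_mul]
      congr 1
      exact Finset.sum_congr rfl fun x _ => (mul_assoc _ _ _).symm
    refine Eq.subst (motive := fun f => HasSum f _) (funext fun w => ?_) (hasSum_fiber h1)
    rw [bottomTransition.eq_1 q p t, fiberMean, mul_div_assoc', Finset.mul_sum, Finset.sum_div]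
    refine Finset.sum_congr rfl fun x hx => ?_
    have hw : bottom x = w := Subtype.ext (mem_fiber.1 hx)
    -- The intertwining makes the intermediate pattern distributed as M_w given its bottom row `w`,
    -- which closes the equation on bottom rows.
    rw [fiberMean_transition hq hp, hw]
    ring
  deriv_zero z z' := by
    classical
    have h1 : Tendsto (fun t : ℝ≥0 => fiberMean q (fun x =>
        ∑ y ∈ (finite_bottom z'.1).toFinset, (p t x y - p 0 x y) / (t : ℝ)) z.1) (𝓝[>] 0)
        (𝓝 (fiberMean q (fun x => ∑ y ∈ (finite_bottom z'.1).toFinset, patternQ q x y) z.1)) :=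
      (tendsto_finsetSum _ fun x _ =>
        (tendsto_finsetSum _ fun y _ => hp.deriv_zero x y).const_mul _).div_const _
    have h2 : ∀ x : Pattern n, ∑ y ∈ (finite_bottom z'.1).toFinset, patternQ q x y =
        patternGen q (fun x => if bottom x = z' then 1 else 0) x := by
      intro x
      simp only [patternQ, patternGen]
      rw [Finset.sum_comm]
      refine Finset.sum_congr rfl fun l _ => ?_
      rw [Finset.sum_comm]
      refine Finset.sum_congr rfl fun j _ => ?_
      rw [← Finset.mul_sum, Finset.sum_sub_distrib, sum_fiber_ite, sum_fiber_ite]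
    have h3 : fiberMean q (fun x => ∑ y ∈ (finite_bottom z'.1).toFinset, patternQ q x y) z.1 =
        weylQ q z z' := by
      simp only [h2]
      -- The derivative is the averaged pattern generator of the indicator of a fibre; by the
      -- intertwining it is the Weyl generator of a point indicator.
      rw [fiberMean_patternGen hq, weylGen, weylQ]
      refine Finset.sum_congr rfl fun i _ => ?_
      rw [fiberMean_bottom_eq hq, fiberMean_bottom_eq hq, schurRate_eq]
      simp only [Subtype.ext_iff, eq_comm]
    rw [h3] at h1
    refine h1.congr fun t => ?_
    simp only [bottomTransition, fiberMean, ← Finset.sum_div, ← mul_div_assoc,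
      Finset.sum_sub_distrib, mul_sub]
    ring

/-! ### Finite-dimensional distributions of the bottom row -/

section FiniteDimensional

variable {n : ℕ} {Ω : Type*}

/-- The event that, at the times `t i`, `i ≤ N`, the bottom row is `z i` if `i < j` and the pattern
is `x i` if `j ≤ i`. -/
def pathEvent (X : ℝ≥0 → Ω → Pattern n) (t : ℕ → ℝ≥0) (N : ℕ) (z : ℕ → Weyl n)
    (j : ℕ) (x : ℕ → Pattern n) : Set Ω :=
  {ω | ∀ i ≤ N, if i < j then bottom (X (t i) ω) = z i else X (t i) ω = x i}

theorem measurableSet_pathEvent [MeasurableSpace Ω] {X : ℝ≥0 → Ω → Pattern n}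
    (hX : ∀ t x, MeasurableSet {ω | X t ω = x}) (t : ℕ → ℝ≥0) (N : ℕ) (z : ℕ → Weyl n) (j : ℕ)
    (x : ℕ → Pattern n) : MeasurableSet (pathEvent X t N z j x) := by
  simp only [pathEvent, Set.ofPred_forall]
  refine MeasurableSet.iInter fun i => MeasurableSet.iInter fun _ => ?_
  split_ifs
  · have : {ω | bottom (X (t i) ω) = z i} =
        ⋃ y ∈ (finite_bottom (z i).1).toFinset, {ω | X (t i) ω = y} := by
      ext ω
      simp only [Set.mem_iUnion, mem_fiber, exists_prop]
      exact ⟨fun h => ⟨_, congrArg Subtype.val h, rfl⟩,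
        fun ⟨y, hy, h⟩ => Subtype.ext ((congrArg (fun x => (bottom x).1) h).trans hy)⟩
    rw [this]
    exact Finset.measurableSet_biUnion _ fun y _ => hX _ y
  · exact hX _ _

theorem pathEvent_succ (X : ℝ≥0 → Ω → Pattern n) (t : ℕ → ℝ≥0) {N : ℕ} (z : ℕ → Weyl n) {j : ℕ}
    (hj : j ≤ N) (x : ℕ → Pattern n) :
    pathEvent X t N z (j + 1) x = ⋃ y ∈ (finite_bottom (z j).1).toFinset,
      pathEvent X t N z j (Function.update x j y) := by
  ext ω
  simp only [Set.mem_iUnion, mem_fiber, exists_prop]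
  constructor
  · intro h
    refine ⟨X (t j) ω, ?_, fun i hi => ?_⟩
    · have := h j hj
      rw [if_pos (Nat.lt_succ_self j)] at this
      rw [this]
    · have := h i hi
      rcases lt_trichotomy i j with hij | rfl | hij
      · rw [if_pos (by omega)] at this
        rwa [if_pos hij]
      · rw [if_neg (lt_irrefl _), Function.update_self]
      · rw [if_neg (by omega)] at this
        rwa [if_neg (by omega), Function.update_of_ne hij.ne']
  · rintro ⟨y, hy, h⟩ i hi
    have := h i hi
    rcases lt_trichotomy i j with hij | rfl | hij
    · rw [if_pos hij] at this
      rwa [if_pos (by omega)]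
    · rw [if_neg (lt_irrefl _), Function.update_self] at this
      rw [if_pos (Nat.lt_succ_self i), this]
      exact Subtype.ext hy
    · rw [if_neg (by omega), Function.update_of_ne hij.ne'] at this
      rwa [if_neg (by omega)]

theorem measureReal_pathEvent_succ [MeasurableSpace Ω] {P : Measure Ω} [IsProbabilityMeasure P]
    {X : ℝ≥0 → Ω → Pattern n} (hX : ∀ t x, MeasurableSet {ω | X t ω = x}) (t : ℕ → ℝ≥0) {N : ℕ}
    (z : ℕ → Weyl n) {j : ℕ} (hj : j ≤ N) (x : ℕ → Pattern n) :
    P.real (pathEvent X t N z (j + 1) x) = ∑ y ∈ (finite_bottom (z j).1).toFinset,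
      P.real (pathEvent X t N z j (Function.update x j y)) := by
  rw [pathEvent_succ X t z hj]
  refine measureReal_biUnion_finset (fun y _ y' _ hne => ?_)
    fun y _ => measurableSet_pathEvent hX t N z j _
  rw [Function.onFun, Set.disjoint_left]
  intro ω h h'
  have h1 := h j hj
  have h2 := h' j hj
  rw [if_neg (lt_irrefl j), Function.update_self] at h1 h2
  exact hne (h1.symm.trans h2)

theorem bottom_surjective (z : Weyl n) : ∃ x : Pattern n, bottom x = z := by
  obtain ⟨x, hx⟩ := fiber_nonempty z.2
  exact ⟨x, Subtype.ext (mem_fiber.1 hx)⟩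

/-- The factor at time `j` is the mass M of the current bottom row, independent of the past bottom
rows. Summing it against the next transition reproduces M one step later, which drives the
induction. -/
theorem measureReal_pathEvent [MeasurableSpace Ω] {P : Measure Ω} [IsProbabilityMeasure P]
    {q : Fin n → ℝ} (hq : ∀ i, 0 < q i) {p : ℝ≥0 → Pattern n → Pattern n → ℝ}
    (hp : IsTransitionFunction (patternQ q) p) {z₀ : Weyl n} {X : ℝ≥0 → Ω → Pattern n}
    (hX : ∀ t x, MeasurableSet {ω | X t ω = x}) {t : ℕ → ℝ≥0} {N : ℕ}
    (hfd : ∀ x : ℕ → Pattern n, P.real {ω | ∀ i ≤ N, X (t i) ω = x i} =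
      patternMass q z₀ (x 0) * ∏ i ∈ Finset.range N, p (t (i + 1) - t i) (x i) (x (i + 1)))
    (z : ℕ → Weyl n) {j : ℕ} (hj : j ≤ N) (x : ℕ → Pattern n) (hx : ∀ i, bottom (x i) = z i) :
    P.real (pathEvent X t N z j x) = pointMass z₀ (z 0) *
      (∏ i ∈ Finset.range j, bottomTransition q p (t (i + 1) - t i) (z i) (z (i + 1))) *
      (weight q (x j) / schur q (z j).1) *
      ∏ i ∈ Finset.Ico j N, p (t (i + 1) - t i) (x i) (x (i + 1)) := by
  induction j generalizing x with
  | zero =>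
    have h0 : pathEvent X t N z 0 x = {ω | ∀ i ≤ N, X (t i) ω = x i} := by
      simp [pathEvent]
    rw [h0, hfd, patternMass, pointMass, hx 0, Finset.range_zero, Finset.prod_empty, mul_one,
      Nat.Ico_zero_eq_range]
    congr 1
    split_ifs with h
    · rw [h, one_mul]
    · rw [zero_mul]
  | succ j ih =>
    rw [measureReal_pathEvent_succ hX t z (by omega)]
    set c := pointMass z₀ (z 0) *
      ∏ i ∈ Finset.range j, bottomTransition q p (t (i + 1) - t i) (z i) (z (i + 1)) with hc
    set r := ∏ i ∈ Finset.Ico (j + 1) N, p (t (i + 1) - t i) (x i) (x (i + 1)) with hr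
    have h1 : ∀ y ∈ (finite_bottom (z j).1).toFinset,
        P.real (pathEvent X t N z j (Function.update x j y)) =
        c * ((weight q y * p (t (j + 1) - t j) y (x (j + 1))) / schur q (z j).1) * r := by
      intro y hy
      rw [ih (by omega) (Function.update x j y), Finset.prod_eq_prod_Ico_succ_bot (by omega),
        Function.update_self, Function.update_of_ne (by omega), hr]
      · have h2 : ∀ i ∈ Finset.Ico (j + 1) N, p (t (i + 1) - t i) (Function.update x j y i)
            (Function.update x j y (i + 1)) = p (t (i + 1) - t i) (x i) (x (i + 1)) := by
          intro i hi
          rw [Finset.mem_Ico] at hi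
          rw [Function.update_of_ne (by omega), Function.update_of_ne (by omega)]
        rw [Finset.prod_congr rfl h2]
        ring
      · intro i
        by_cases hij : i = j
        · subst hij
          rw [Function.update_self]
          exact Subtype.ext (mem_fiber.1 hy)
        · rw [Function.update_of_ne hij, hx]
    rw [Finset.sum_congr rfl h1, ← Finset.sum_mul, ← Finset.mul_sum, ← Finset.sum_div]
    have h3 := fiberMean_transition hq hp (t (j + 1) - t j) (z j) (x (j + 1))
    rw [fiberMean, hx] at h3
    rw [h3, Finset.prod_range_succ, ← mul_assoc (pointMass z₀ (z 0)), ← hc]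
    ring

theorem isMarkovProcess_bottom [MeasurableSpace Ω] {P : Measure Ω} [IsProbabilityMeasure P]
    {q : Fin n → ℝ} (hq : ∀ i, 0 < q i) {z₀ : Weyl n} {X : ℝ≥0 → Ω → Pattern n}
    (h : IsMarkovProcess P (patternQ q) (patternMass q z₀) X) :
    IsMarkovProcess P (weylQ q) (pointMass z₀) (fun t ω => bottom (X t ω)) := by
  obtain ⟨hX, p, hp, hfd⟩ := h
  refine ⟨fun t z => ?_, bottomTransition q p, isTransitionFunction_bottomTransition hq hp,
    fun N t z ht0 ht => ?_⟩
  · obtain ⟨x, _⟩ := bottom_surjective z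
    have := measurableSet_pathEvent hX (fun _ => t) 0 (fun _ => z) 1 (fun _ => x)
    simpa [pathEvent] using this
  -- An arbitrary lift: at index `N + 1` no condition on `x` remains in the event.
  · choose x hx using fun i => bottom_surjective (z i)
    have h1 : {ω | ∀ i ≤ N, bottom (X (t i) ω) = z i} = pathEvent X t N z (N + 1) x := by
      ext ω
      refine forall_congr' fun i => forall_congr' fun hi => ?_
      rw [if_pos (by omega)]
    rw [h1, measureReal_pathEvent_succ hX t z le_rfl]
    have h2 : ∀ y ∈ (finite_bottom (z N).1).toFinset,
        P.real (pathEvent X t N z N (Function.update x N y)) =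
        pointMass z₀ (z 0) *
        (∏ i ∈ Finset.range N, bottomTransition q p (t (i + 1) - t i) (z i) (z (i + 1))) *
        (weight q y / schur q (z N).1) := by
      intro y hy
      rw [measureReal_pathEvent hq hp hX (fun x => hfd N t x ht0 ht) z le_rfl, Finset.Ico_self,
        Finset.prod_empty, mul_one, Function.update_self]
      intro i
      by_cases hij : i = N
      · subst hij
        rw [Function.update_self]
        exact Subtype.ext (mem_fiber.1 hy)
      · rw [Function.update_of_ne hij, hx]
    rw [Finset.sum_congr rfl h2, ← Finset.mul_sum, ← Finset.sum_div, ← schur,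
      div_self (schur_pos hq (z N).2).ne', mul_one]

end FiniteDimensional

/-! ### The Doob transform -/

theorem harmonicH_pos {n : ℕ} {q : Fin n → ℝ} (hq : ∀ i, 0 < q i) (x : Weyl n) :
    0 < harmonicH q x :=
  mul_pos (Finset.prod_pos fun i _ => zpow_pos (hq i) _) (schur_pos hq x.2)

theorem mul_prod_zpow_neg_add_single {n : ℕ} {q : Fin n → ℝ} (hq : ∀ i, 0 < q i)
    (x : Fin n → ℤ) (i : Fin n) :
    q i * ∏ k, q k ^ (-(x + Pi.single i 1 : Fin n → ℤ) k) = ∏ k, q k ^ (-x k) := by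
  have h : ∀ k, q k ^ (-x k) =
      (if k = i then q k else 1) * q k ^ (-(x + Pi.single i 1 : Fin n → ℤ) k) := by
    intro k
    rw [Pi.add_apply, Pi.single_apply]
    split_ifs
    · rw [← zpow_one_add₀ (hq k).ne']
      congr 1
      ring
    · rw [one_mul, add_zero]
  rw [Finset.prod_congr rfl fun k _ => h k, Finset.prod_mul_distrib, Finset.prod_ite_eq',
    if_pos (Finset.mem_univ i)]

/-- This is the Pieri rule: since the Schur function vanishes off the chamber, the killed steps may
be added to the sum at no cost. -/
theorem isHarmonicFor_killedWalkQ {n : ℕ} {q : Fin n → ℝ} (hq : ∀ i, 0 < q i) :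
    IsHarmonicFor (killedWalkQ q) (harmonicH q) := by
  classical
  intro x
  have h1 : ∀ v : Fin n → ℤ, HasSum (fun y : Weyl n => (if y.1 = v then 1 else 0) * harmonicH q y)
      ((∏ k, q k ^ (-v k)) * schur q v) := by
    intro v
    by_cases hv : Monotone v
    · have h2 := hasSum_single (f := fun y : Weyl n =>
        (if y.1 = v then 1 else 0) * harmonicH q y) ⟨v, hv⟩ fun y hy => by
          rw [if_neg fun h => hy (Subtype.ext h), zero_mul]
      rwa [if_pos rfl, one_mul] at h2
    · have h2 : ∀ y : Weyl n, (if y.1 = v then 1 else 0) * harmonicH q y = 0 := by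
        intro y
        rw [if_neg, zero_mul]
        rintro rfl
        exact hv y.2
      simp only [h2, schur_of_not_monotone hv, mul_zero]
      exact hasSum_zero
  have h3 := hasSum_sum fun i (_ : i ∈ Finset.univ) =>
    ((h1 (x.1 + Pi.single i 1)).sub (h1 x.1)).mul_left (q i)
  have h4 : ∑ i, q i * ((∏ k, q k ^ (-(x.1 + Pi.single i 1 : Fin n → ℤ) k)) *
      schur q (x.1 + Pi.single i 1) -
      (∏ k, q k ^ (-x.1 k)) * schur q x.1) = 0 := by
    simp only [mul_sub, ← mul_assoc, mul_prod_zpow_neg_add_single hq]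
    rw [Finset.sum_sub_distrib, ← Finset.mul_sum, sum_schur_add_single hq x.2, ← Finset.sum_mul,
      ← Finset.sum_mul]
    ring
  rw [h4] at h3
  refine Eq.subst (motive := fun f => HasSum f _) (funext fun y => ?_) h3
  rw [killedWalkQ, Finset.sum_mul]
  refine Finset.sum_congr rfl fun i _ => ?_
  simp only [Subtype.ext_iff]
  ring

/-- In `q i * h (x + e_i) / h x` the powers of `q` cancel, leaving the Schur ratio; the diagonal
entries agree because both total rates are `∑ i, q i`. -/
theorem weylQ_eq_doobTransform {n : ℕ} {q : Fin n → ℝ} (hq : ∀ i, 0 < q i) :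
    weylQ q = doobTransform (killedWalkQ q) (harmonicH q) := by
  classical
  funext x y
  have hh := (harmonicH_pos hq x).ne'
  simp only [weylQ, doobTransform, killedWalkQ, mul_sub, Finset.sum_sub_distrib, sub_mul, sub_div,
    Finset.sum_mul, Finset.sum_div, schurRate_eq]
  congr 1
  · refine Finset.sum_congr rfl fun i _ => ?_
    split_ifs with h
    · have hP : ∏ k, q k ^ (-y.1 k) ≠ 0 :=
        (Finset.prod_pos fun k _ => zpow_pos (hq k) _).ne'
      have hS := (schur_pos hq x.2).ne'
      have hi := (hq i).ne'
      rw [harmonicH, harmonicH, ← mul_prod_zpow_neg_add_single hq x.1 i, ← h]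
      field_simp
    · simp
  · rw [← Finset.sum_mul, sum_rate hq x.2]
    split_ifs with h
    · subst h
      rw [Finset.sum_mul]
      exact Finset.sum_congr rfl fun i _ => (mul_div_cancel_right₀ _ hh).symm
    · simp

end GelfandTsetlin

theorem theorem1 (n : ℕ) (q : Fin n → ℝ) (hq : ∀ i, 0 < q i) :
    (∀ (z : GelfandTsetlin.Weyl n) (Ω : Type*) [MeasurableSpace Ω] (P : Measure Ω)
        [IsProbabilityMeasure P] (X : ℝ≥0 → Ω → GelfandTsetlin.Pattern n),
      IsMarkovProcess P (GelfandTsetlin.patternQ q) (GelfandTsetlin.patternMass q z) X →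
      IsMarkovProcess P (GelfandTsetlin.weylQ q) (GelfandTsetlin.pointMass z)
        (fun t ω => GelfandTsetlin.bottom (X t ω))) ∧
    (∀ x, 0 < GelfandTsetlin.harmonicH q x) ∧
    GelfandTsetlin.IsHarmonicFor (GelfandTsetlin.killedWalkQ q) (GelfandTsetlin.harmonicH q) ∧
    GelfandTsetlin.weylQ q =
      GelfandTsetlin.doobTransform (GelfandTsetlin.killedWalkQ q) (GelfandTsetlin.harmonicH q) :=
  ⟨fun _ _ _ _ _ _ h => GelfandTsetlin.isMarkovProcess_bottom hq h,
    GelfandTsetlin.harmonicH_pos hq, GelfandTsetlin.isHarmonicFor_killedWalkQ hq,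
    GelfandTsetlin.weylQ_eq_doobTransform hq⟩
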